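/- **Corollary (PFA implies SCH).** Assume the Proper Forcing Axiom (PFA): for every proper forcing notion $P$ (a nonempty preordered set) and every family $\mathcal D$ of at most $\aleph_1$ dense subsets of $P$ there is a filter $G\subseteq P$ with $G\cap D\neq\emptyset$ for all $D\in\mathcal D$. Then the Singular Cardinal Hypothesis (SCH) holds: $2^\kappa=\kappa^+$ for every singular strong limit cardinal $\kappa$. Here $[X]^\omega$ is the set of countably infinite subsets of $X$. A set $C\subseteq[X]^\omega$ is club if, for some $f:[X]^{<\omega}\to X$, it is the set of all $Y\in[X]^\omega$ that are closed under $f$ (that is, $f(e)\in Y$ for every finite $e\subseteq Y$). A set $S\subseteq[X]^\omega$ is stationary if it meets every club subset of $[X]^\omega$. The forcing notion $P$ is proper if for every uncountable set $X$, every stationary $S\subseteq[X]^\omega$ remains stationary in every generic extension by $P$; equivalently, for every $P$-name $\dot F$ for a function $[X]^{<\omega}\to X$ and every $p\in P$ there are $q\le p$ and $Y\in S$ such that $q$ forces $Y$ to be closed under $\dot F$. -/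

import Mathlib

universe u

namespace PFA

/-! ### Club and stationary subsets of `[X]^ω` -/

/-- `[X]^ω`: the family of all countably infinite subsets of `X`. -/
def countableSubsets (X : Type u) : Set (Set X) :=
  {Y | Y.Countable ∧ Y.Infinite}

/-- `f[Y]^{<ω} ⊆ Y`: the set `Y` is closed under `f : [X]^{<ω} → X`. -/
def IsClosedUnder {X : Type u} (f : Finset X → X) (Y : Set X) : Prop :=
  ∀ e : Finset X, (e : Set X) ⊆ Y → f e ∈ Y

/-- `C ⊆ [X]^ω` is a club if it consists, for some `f : [X]^{<ω} → X`, of all `Y ∈ [X]^ω` that are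
closed under `f`. -/
def IsClubCtbl {X : Type u} (C : Set (Set X)) : Prop :=
  ∃ f : Finset X → X, C = {Y | Y ∈ countableSubsets X ∧ IsClosedUnder f Y}

/-- `S ⊆ [X]^ω` is stationary if it meets every club of `[X]^ω`. -/
def IsStationaryCtbl {X : Type u} (S : Set (Set X)) : Prop :=
  S ⊆ countableSubsets X ∧ ∀ C : Set (Set X), IsClubCtbl C → (S ∩ C).Nonempty

/-! ### Forcing notions

A forcing notion is a nonempty preordered type `P`; `q ≤ p` means that the condition `q` is
stronger than (extends) `p`. -/

/-- `D` is dense in `P`: every condition has an extension in `D`. -/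
def IsDense {P : Type u} [Preorder P] (D : Set P) : Prop :=
  ∀ p : P, ∃ q ∈ D, q ≤ p

/-- A `P`-name for a function from `A` to `B`, where `A` and `B` are ground model sets. The name is
a set of pairs `((a, b), p)`, given here by the sets `val a b = {p | ((a, b), p) is in the name}`;
its evaluation by a `V`-generic filter `G` is the relation `{(a, b) | G ∩ val a b ≠ ∅}`. The two
other fields say that every condition forces this relation to be a function with domain `A`. -/
structure FunctionName (P : Type u) [Preorder P] (A B : Type u) where
  val : A → B → Set P
  total : ∀ (a : A) (p : P), ∃ q ≤ p, ∃ b : B, ∃ r ∈ val a b, q ≤ r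
  unique : ∀ (a : A) (b b' : B), ∀ r ∈ val a b, ∀ r' ∈ val a b',
    (∃ s : P, s ≤ r ∧ s ≤ r') → b = b'

/-- `q ⊩ F(a) ∈ Y`, for a ground model set `Y ⊆ B`: the conditions that lie below a member of
`val a b` for some `b ∈ Y` are dense below `q`. -/
def FunctionName.ForcesMem {P : Type u} [Preorder P] {A B : Type u} (F : FunctionName P A B)
    (q : P) (a : A) (Y : Set B) : Prop :=
  ∀ r ≤ q, ∃ s ≤ r, ∃ b ∈ Y, ∃ t ∈ F.val a b, s ≤ t

/-- `q ⊩ F[Y]^{<ω} ⊆ Y`, where `F` is a name for a function `[X]^{<ω} → X` and `Y ⊆ X` is a ground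
model set. -/
def FunctionName.ForcesClosed {P : Type u} [Preorder P] {X : Type u}
    (F : FunctionName P (Finset X) X) (q : P) (Y : Set X) : Prop :=
  ∀ e : Finset X, (e : Set X) ⊆ Y → F.ForcesMem q e Y

/-- Every condition of `P` forces that the ground model set `S ⊆ [X]^ω` is stationary in the generic
extension: for every name `F` for a function `[X]^{<ω} → X`, it is dense to find a condition `q`
and a set `Y ∈ S` such that `q` forces `Y` to be closed under `F`. -/
def ForcesStationary (P : Type u) [Preorder P] {X : Type u} (S : Set (Set X)) : Prop :=
  ∀ F : FunctionName P (Finset X) X, ∀ p : P, ∃ q ≤ p, ∃ Y ∈ S, F.ForcesClosed q Y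

/-- `P` is proper: for every uncountable set `X`, every stationary subset of `[X]^ω` remains
stationary in every generic extension by `P`. -/
def IsProper (P : Type u) [Preorder P] : Prop :=
  ∀ X : Type u, Uncountable X → ∀ S : Set (Set X), IsStationaryCtbl S → ForcesStationary P S

/-- The Proper Forcing Axiom: for every proper forcing notion `P` and every family `𝒟` of at most
`ℵ₁` dense subsets of `P` there is a filter on `P` that meets every member of `𝒟`. -/
def ProperForcingAxiom : Prop :=
  ∀ (P : Type u) [Preorder P] [Nonempty P], IsProper P →
    ∀ 𝒟 : Set (Set P), Cardinal.mk 𝒟 ≤ Cardinal.aleph 1 → (∀ D ∈ 𝒟, IsDense D) →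
      ∃ G : Order.PFilter P, ∀ D ∈ 𝒟, ((G : Set P) ∩ D).Nonempty

/-- The Singular Cardinal Hypothesis: `2 ^ κ = κ⁺` for every singular strong limit cardinal `κ`. -/
def SingularCardinalHypothesis : Prop :=
  ∀ κ : Cardinal.{u}, κ.IsSingular → κ.IsStrongLimit → 2 ^ κ = Order.succ κ

end PFA

/-!
The proof is by induction on the singular strong limit cardinal `κ`, with two cases.

*Uncountable cofinality* (`PFA.two_power_le_succ_of_forall_lt`). This is Silver's theorem, proved in
ZFC by comparing subsets of `κ` through their traces on an increasing sequence of sets of smaller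
cardinality: any two distinct subsets are comparable on a stationary set of indices, and, by
pressing down, a given subset has at most `κ` predecessors.

*Countable cofinality* (`PFA.ProperForcingAxiom.two_power_le_succ`). Let `T = κ⁺`. Every `β < κ⁺` is
an increasing union of sets of size less than `κ`, and by closing off these sets one gets a coherent
matrix of sets `D n β` of size less than `κ` with `Iio β ⊆ ⋃ n, D n β` (`PFA.reach`). Since
`2 ^ ℵ₀ < κ`, each countable set has a largest trace of a column, up to a shift of rows
(`PFA.exists_forall_inter_subset`). So the countable sets that meet every `D n β` in a finite set
form a P-ideal `I`. An uncountable set with all countable subsets in `I` cannot exist, as one of the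
sets `D n β` would meet it in an infinite set. The Proper Forcing Axiom therefore gives an unbounded
set `E ⊆ κ⁺` without infinite subsets in `I`, and a diagonal argument shows that each countable
subset of `E` is contained in some `D n β` (`PFA.ProperForcingAxiom.exists_covered`). Counting these
subsets gives `2 ^ κ ≤ κ ^ ℵ₀ ≤ κ⁺`.

The axiom is used in `PFA.ProperForcingAxiom.exists_uncountable`, a form of the P-ideal dichotomy
for a linear order `T` in which countable sets are bounded. The conditions of the forcing are finite
chains of countable models, each with a point of `T` above it; a model `v` promises that later
points inserted below it lie in a set `A v ∈ I` which almost contains all members of `I` in `v`. The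
forcing is proper (`PFA.isProper_condition`): the points of a condition above a model `m` show that
unboundedly many points of `T` can be chosen for the first new point, then for the second one, and
so on. Each unbounded set involved contains an infinite member of `I` that lies in `m`, so that the
choice can be made inside `m` and in the finitely many sets `A v` that matter.

Elementary submodels are replaced by countable sets closed under finitary operations with countable
values (`PFA.HoldsOnClub`); `PFA.IsStationaryCtbl.exists_closedUnder_preimage` finds such sets with
trace in a given stationary set. -/

/-! ### Countable models -/

namespace PFA

open Set Cardinal

/-- `M` is closed under the set-valued operation `H` on finite subsets. -/
def ClosedUnder {W : Type u} (H : Finset W → Set W) (M : Set W) : Prop :=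
  ∀ e : Finset W, (e : Set W) ⊆ M → H e ⊆ M

/-- A countable family of finitary operations on an infinite set, presented as an operation `h` with
countable values, can be coded by a single function `[X]^{<ω} → X`. Hence a stationary set has
a member closed under `h`. -/
theorem IsStationaryCtbl.exists_closedUnder {X : Type u} [Infinite X] {S : Set (Set X)}
    (hS : IsStationaryCtbl S) (h : Finset X → Set X) (hh : ∀ e, (h e).Countable) :
    ∃ Y ∈ S, ClosedUnder h Y := by
  classical
  let a : ℕ ↪ X := Infinite.natEmbedding X
  have hg : ∀ e, ∃ g : ℕ → X, insert (a 0) (h e) = range g := fun e =>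
    ((hh e).insert _).exists_eq_range (insert_nonempty _ _)
  choose g hg using hg
  -- The trace of `e` on the copy `range a` of `ℕ`, together with the index of an operation, is
  -- recorded by one number `N`, and `N` is marked by the two points `a N` and `a (N + 1)`.
  let tr : Finset X → Finset ℕ := fun e => e.preimage a a.injective.injOn
  let N : ℕ × Finset X → ℕ := fun z => Encodable.encode (z.1, tr z.2)
  let c : ℕ × Finset X → Finset X := fun z =>
    (z.2.filter (· ∉ range a)) ∪ {a (N z), a (N z + 1)}
  have hmem : ∀ z n, a n ∈ c z ↔ n = N z ∨ n = N z + 1 := by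
    intro z n
    simp [c]
  have hcinj : Function.Injective c := by
    intro z w hzw
    have h1 := hmem z; rw [hzw] at h1
    have hN : N z = N w := by
      have e1 := (hmem w (N z)).1 ((h1 _).2 (Or.inl rfl))
      have e2 := (h1 (N w)).1 ((hmem w _).2 (Or.inl rfl))
      omega
    have h2 : (z.1, tr z.2) = (w.1, tr w.2) := Encodable.encode_injective hN
    have h3 : z.1 = w.1 := (Prod.ext_iff.1 h2).1
    have h4 : tr z.2 = tr w.2 := (Prod.ext_iff.1 h2).2
    refine Prod.ext h3 (Finset.ext fun x => ?_)
    by_cases hx : x ∈ range a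
    · obtain ⟨n, rfl⟩ := hx
      have := Finset.ext_iff.1 h4 n
      simpa [tr] using this
    · have := Finset.ext_iff.1 hzw x
      have hx' : ∀ n, x ≠ a n := fun n hn => hx ⟨n, hn.symm⟩
      simpa [c, hx', fun n => (hx' n).symm] using this
  let d : Option ℕ ⊕ (ℕ × Finset X) → Finset X :=
    Sum.elim (fun o => o.elim ∅ fun n => {a n}) c
  have hd : Function.Injective d := by
    refine Function.Injective.sumElim ?_ hcinj ?_
    · rintro (_ | n) (_ | m) hnm
      · rfl
      · simp at hnm
      · simp at hnm
      · simpa using hnm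
    · rintro (_ | n) z hz
      · have := (hmem z (N z)).2 (Or.inl rfl)
        rw [← hz] at this
        simp at this
      · have e1 := (hmem z (N z)).2 (Or.inl rfl)
        have e2 := (hmem z (N z + 1)).2 (Or.inr rfl)
        rw [← hz] at e1 e2
        simp at e1 e2
        omega
  let v : Option ℕ ⊕ (ℕ × Finset X) → X :=
    Sum.elim (fun o => o.elim (a 0) fun n => a (n + 1)) (fun z => g z.2 z.1)
  let f : Finset X → X := Function.extend d v fun _ => a 0
  have hf : ∀ z, f (d z) = v z := fun z => hd.extend_apply _ _ _
  obtain ⟨Y, hYS, -, hY⟩ := hS.2 _ ⟨f, rfl⟩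
  have ha : ∀ n, a n ∈ Y := by
    intro n
    induction n with
    | zero =>
      have := hY (d (.inl none)) (by simp [d])
      rwa [hf] at this
    | succ n ih =>
      have := hY (d (.inl (some n))) (by simpa [d] using ih)
      rwa [hf] at this
  refine ⟨Y, hYS, fun e he x hx => ?_⟩
  have hx' : x ∈ range (g e) := hg e ▸ mem_insert_of_mem _ hx
  obtain ⟨i, rfl⟩ := hx'
  have := hY (d (.inr (i, e))) (by
    intro x hx
    simp only [d, c, Sum.elim_inr, Finset.coe_union, Finset.coe_filter, mem_union, mem_ofPred_eq,
      Finset.coe_insert, Finset.coe_singleton, mem_insert_iff, mem_singleton_iff] at hx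
    rcases hx with ⟨hx, -⟩ | rfl | rfl
    · exact he hx
    · exact ha _
    · exact ha _)
  rwa [hf] at this

theorem countable_finset_subset {W : Type u} {M : Set W} (hM : M.Countable) :
    {e : Finset W | (e : Set W) ⊆ M}.Countable := by
  refine ((countable_ofPred_finite_subset hM).preimage_of_injOn
    (f := fun e : Finset W => (e : Set W)) Finset.coe_injective.injOn).mono fun e he => ?_
  exact ⟨e.finite_toSet, he⟩

theorem exists_countable_closedUnder {W : Type u} (H : Finset W → Set W)
    (hH : ∀ e, (H e).Countable) {E : Set W} (hE : E.Countable) :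
    ∃ M, E ⊆ M ∧ M.Countable ∧ ClosedUnder H M := by
  let step : Set W → Set W := fun M => M ∪ ⋃ e ∈ {e : Finset W | (e : Set W) ⊆ M}, H e
  let it : ℕ → Set W := fun n => step^[n] E
  have hit : ∀ n, it (n + 1) = step (it n) := fun n => Function.iterate_succ_apply' _ _ _
  have hmono : Monotone it := monotone_nat_of_le_succ fun n => by
    rw [hit]; exact subset_union_left
  have hcount : ∀ n, (it n).Countable := by
    intro n
    induction n with
    | zero => exact hE
    | succ n ih =>
      rw [hit]
      refine ih.union (Countable.biUnion ?_ fun e _ => hH e)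
      exact countable_finset_subset ih
  refine ⟨⋃ n, it n, subset_iUnion it 0, countable_iUnion hcount, fun e he => ?_⟩
  obtain ⟨n, hn⟩ := (directed_of_isDirected_le hmono).exists_mem_subset_of_finset_subset_biUnion he
  refine Subset.trans ?_ (subset_iUnion it (n + 1))
  rw [hit]
  exact Subset.trans (subset_biUnion_of_mem (u := H) hn) subset_union_right

/-- Stationary sets lift along injections: if `S ⊆ [X]^ω` is stationary, then some countable subset
of `W` closed under `H` has its trace on `X` in `S`. -/
theorem IsStationaryCtbl.exists_closedUnder_preimage {X W : Type u} [Infinite X] {S : Set (Set X)}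
    (hS : IsStationaryCtbl S) {ι : X → W} (hι : Function.Injective ι) (H : Finset W → Set W)
    (hH : ∀ e, (H e).Countable) : ∃ M : Set W, M.Countable ∧ ClosedUnder H M ∧ ι ⁻¹' M ∈ S := by
  classical
  let cl : Finset X → Set W := fun e => ⋂₀ {M | ι '' e ⊆ M ∧ ClosedUnder H M}
  have hclsub : ∀ e : Finset X, ι '' e ⊆ cl e := fun e => subset_sInter fun M hM => hM.1
  have hclcl : ∀ e, ClosedUnder H (cl e) := fun e e' he' =>
    subset_sInter fun M hM => hM.2 e' (he'.trans (sInter_subset_of_mem hM))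
  have hclmono : Monotone cl := fun e e' hee' =>
    sInter_subset_sInter fun M hM => ⟨(image_mono (Finset.coe_subset.2 hee')).trans hM.1, hM.2⟩
  have hclcount : ∀ e, (cl e).Countable := fun e => by
    obtain ⟨M, h1, h2, h3⟩ :=
      exists_countable_closedUnder H hH ((e.finite_toSet.image ι).countable)
    exact h2.mono (sInter_subset_of_mem ⟨h1, h3⟩)
  obtain ⟨Y, hYS, hY⟩ := hS.exists_closedUnder (fun e => ι ⁻¹' cl e)
    fun e => (hclcount e).preimage_of_injOn hι.injOn
  have hYc : Y.Countable := (hS.1 hYS).1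
  let J := {e : Finset X // (e : Set X) ⊆ Y}
  have hJ : Countable J := countable_finset_subset hYc
  have hdir : Directed (· ⊆ ·) fun j : J => cl j.1 := fun i j =>
    ⟨⟨i.1 ∪ j.1, by simpa using ⟨i.2, j.2⟩⟩, hclmono Finset.subset_union_left,
      hclmono Finset.subset_union_right⟩
  have : Nonempty J := ⟨⟨∅, by simp⟩⟩
  refine ⟨⋃ j : J, cl j.1, countable_iUnion fun j => hclcount _, fun e he => ?_, ?_⟩
  · obtain ⟨j, hj⟩ := hdir.exists_mem_subset_of_finset_subset_biUnion he
    exact (hclcl _ e hj).trans (subset_iUnion (fun j : J => cl j.1) j)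
  · convert hYS
    refine Subset.antisymm ?_ fun y hy => ?_
    · rw [preimage_iUnion]
      exact iUnion_subset fun j => hY j.1 j.2
    · exact mem_iUnion.2 ⟨⟨{y}, by simpa using hy⟩, hclsub _ ⟨y, by simp, rfl⟩⟩

/-- `Φ` holds for all members of a club of countable subsets of `W`. The club is presented by
a set-valued operation on finite subsets. -/
def HoldsOnClub {W : Type u} (Φ : Set W → Prop) : Prop :=
  ∃ H : Finset W → Set W, (∀ e, (H e).Countable) ∧ ∀ M : Set W, M.Countable → ClosedUnder H M → Φ M

theorem HoldsOnClub.mono {W : Type u} {Φ Ψ : Set W → Prop} (h : HoldsOnClub Φ)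
    (hΨ : ∀ M, M.Countable → Φ M → Ψ M) : HoldsOnClub Ψ := by
  obtain ⟨H, h1, h2⟩ := h
  exact ⟨H, h1, fun M hM hc => hΨ M hM (h2 M hM hc)⟩

theorem HoldsOnClub.and {W : Type u} {Φ Ψ : Set W → Prop} (h : HoldsOnClub Φ)
    (h' : HoldsOnClub Ψ) : HoldsOnClub fun M => Φ M ∧ Ψ M := by
  obtain ⟨H, h1, h2⟩ := h
  obtain ⟨H', h1', h2'⟩ := h'
  refine ⟨fun e => H e ∪ H' e, fun e => (h1 e).union (h1' e), fun M hM hc =>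
    ⟨h2 M hM fun e he => ?_, h2' M hM fun e he => ?_⟩⟩
  · exact subset_union_left.trans (hc e he)
  · exact subset_union_right.trans (hc e he)

theorem holdsOnClub_closedUnder {W : Type u} (H : Finset W → Set W) (hH : ∀ e, (H e).Countable) :
    HoldsOnClub (ClosedUnder H) :=
  ⟨H, hH, fun _ _ h => h⟩

/-- Closure under operations whose arguments `j : J` are determined by finite lists of elements
of `W`. -/
theorem holdsOnClub_of_list {W : Type u} {J : Type*} (dep : J → List W)
    (hdep : Function.Injective dep) (g : J → Set W) (hg : ∀ j, (g j).Countable) :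
    HoldsOnClub fun M : Set W => ∀ j, (∀ x ∈ dep j, x ∈ M) → g j ⊆ M := by
  classical
  have hc : ∀ e : Finset W, {j | ∀ x ∈ dep j, x ∈ e}.Countable := fun e => by
    have : {l : List W | ∀ x ∈ l, x ∈ (e : Set W)}.Countable := by
      rw [← range_list_map_coe]
      exact countable_range _
    exact this.preimage_of_injOn hdep.injOn
  refine ⟨fun e => ⋃ j ∈ {j | ∀ x ∈ dep j, x ∈ e}, g j, fun e => (hc e).biUnion fun j _ => hg j,
    fun M _ hM j hj => ?_⟩
  refine Subset.trans ?_ (hM (dep j).toFinset (by simpa [subset_def] using hj))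
  exact subset_biUnion_of_mem (u := g) (show j ∈ {j' | ∀ x ∈ dep j', x ∈ (dep j).toFinset} by simp)

/-- A criterion for properness: for every family of dense sets, club many countable `M` have
generic conditions `q` below any given condition. The elements of `P` and the indices of the dense
sets that lie in `M` are those in the respective summands. -/
theorem isProper_of_holdsOnClub {P : Type u} [Preorder P] (U : Type u)
    (h : ∀ (Z : Type u) (D : Z → Set P), (∀ z, IsDense (D z)) → ∀ p : P,
      HoldsOnClub fun M : Set (Z ⊕ P ⊕ U) => ∃ q ≤ p, ∀ z, .inl z ∈ M → ∀ r ≤ q,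
        ∃ s ∈ D z, .inr (.inl s) ∈ M ∧ ∃ t, t ≤ s ∧ t ≤ r) :
    IsProper P := by
  classical
  intro X hX S hS F p
  let D : Finset X → Set P := fun z => {s | ∃ b, ∃ t ∈ F.val z b, s ≤ t}
  have hD : ∀ z, IsDense (D z) := fun z p => by
    obtain ⟨q, hq, b, r, hr, hqr⟩ := F.total z p
    exact ⟨q, ⟨b, r, hr, hqr⟩, hq⟩
  have h1 := h (Finset X) D hD p
  have h2 : HoldsOnClub fun M : Set (Finset X ⊕ P ⊕ U) => ∀ l : List X,
      (∀ x ∈ l.map fun x => Sum.inl {x}, x ∈ M) → {Sum.inl l.toFinset} ⊆ M :=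
    holdsOnClub_of_list _ (List.map_injective_iff.2 fun x y hxy => by simpa using hxy) _
      fun _ => countable_singleton _
  have h3 : HoldsOnClub fun M : Set (Finset X ⊕ P ⊕ U) =>
      ∀ j : (z : Finset X) × {s : P // s ∈ D z},
      (∀ x ∈ [Sum.inl j.1, Sum.inr (Sum.inl j.2.1)], x ∈ M) →
        {Sum.inl {j.2.2.choose}} ⊆ M :=
    holdsOnClub_of_list _ (by
      rintro ⟨z, s, hs⟩ ⟨z', s', hs'⟩ hj
      simp at hj
      obtain ⟨rfl, rfl⟩ := hj
      rfl) _ fun _ => countable_singleton _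
  obtain ⟨H, hHc, hH⟩ := (h1.and h2).and h3
  obtain ⟨M, hMc, hM, hMS⟩ := hS.exists_closedUnder_preimage
    (ι := fun x => (Sum.inl {x} : Finset X ⊕ P ⊕ U)) (fun x y hxy => by simpa using hxy) H hHc
  obtain ⟨⟨⟨q, hqp, hq⟩, hfin⟩, hval⟩ := hH M hMc hM
  refine ⟨q, hqp, _, hMS, fun e he r hr => ?_⟩
  have heM : Sum.inl e ∈ M := by
    have := hfin e.toList (by simpa using fun x hx => he hx)
    simpa using this
  obtain ⟨s, hsD, hsM, t, hts, htr⟩ := hq e heM r hr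
  have hb := hsD.choose_spec
  obtain ⟨t', ht', hst'⟩ := hb
  refine ⟨t, htr, hsD.choose, ?_, t', ht', hts.trans hst'⟩
  simpa using hval ⟨e, s, hsD⟩ (by simpa using ⟨heM, hsM⟩)

end PFA

/-! ### The forcing notion -/

namespace PFA

open Set Cardinal

/-- Codes for the elements and the subsets of the models: sets of finite sequences in `T`. -/
abbrev Code (T : Type u) : Type u := Set (List T)

/-- The code of a point of `T`. -/
def pt {T : Type u} (t : T) : Code T := {[t]}

/-- The code of a subset of `T`. -/
def codeSet {T : Type u} (y : Set T) : Code T := {l | ∃ t ∈ y, l = [t]}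

/-- The subset of `T` coded by `w`. -/
def decodeSet {T : Type u} (w : Code T) : Set T := {t | [t] ∈ w}

theorem pt_injective {T : Type u} : Function.Injective (pt (T := T)) := fun s t h => by
  simpa only [pt, singleton_eq_singleton_iff, List.cons.injEq, and_true] using h

@[simp]
theorem decodeSet_codeSet {T : Type u} (y : Set T) : decodeSet (codeSet y) = y := by
  ext t
  simp [decodeSet, codeSet]

/-- Since `T` is infinite, countable sets of codes can themselves be coded. -/
theorem exists_code (T : Type u) [Infinite T] :
    ∃ dec : Code T → Set (Code T), (∀ u, (dec u).Countable) ∧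
      ∀ N : Set (Code T), N.Countable → N.Nonempty → ∃ u, dec u = N := by
  have e1 : (ℕ × List T) ≃ List T := by
    refine Classical.choice (Cardinal.eq.1 ?_)
    simp
  let e : Code T ≃ (ℕ → Code T) :=
    ((Equiv.Set.congr e1).symm.trans (Equiv.refl (ℕ × List T → Prop))).trans
      (Equiv.curry ℕ (List T) Prop)
  refine ⟨fun u => range (e u), fun u => countable_range _, fun N hN hN' => ?_⟩
  obtain ⟨g, rfl⟩ := hN.exists_eq_range hN'
  exact ⟨e.symm g, by simp⟩

section Forcing

variable {T : Type u} [LinearOrder T]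

/-- The set coded by `u` is a countable model: it is transitive with respect to the coding `dec`,
and it contains a bound of `{η | l ++ [η] ∈ G}` whenever it contains `G` and the entries of `l` and
this set is bounded. -/
structure IsModel (dec : Code T → Set (Code T)) (u : Code T) : Prop where
  trans : ∀ v ∈ dec u, dec v ⊆ dec u
  bound : ∀ G ∈ dec u, ∀ l : List T, (∀ x ∈ l, pt x ∈ dec u) → BddAbove {η | l ++ [η] ∈ G} →
    ∃ b, pt b ∈ dec u ∧ b ∈ upperBounds {η | l ++ [η] ∈ G}

theorem exists_bound [Nonempty T] : ∃ bd : Code T → List T → T, ∀ G l,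
    BddAbove {η | l ++ [η] ∈ G} → bd G l ∈ upperBounds {η | l ++ [η] ∈ G} := by
  have hbd : ∀ (G : Code T) (l : List T), ∃ b : T, BddAbove {η | l ++ [η] ∈ G} →
      b ∈ upperBounds {η | l ++ [η] ∈ G} := by
    intro G l
    by_cases h : BddAbove {η | l ++ [η] ∈ G}
    · obtain ⟨b, hb⟩ := h
      exact ⟨b, fun _ => hb⟩
    · exact ⟨Classical.arbitrary T, fun h' => (h h').elim⟩
  choose bd hbd using hbd
  exact ⟨bd, hbd⟩

/-- The conditions: finite chains of models `u`, each with a point of `T` above the model that lies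
in all later models. A model `u` precedes a model `v` if it is an element of `dec v`. The parameter
`A` enters only the ordering of the conditions. -/
@[ext]
structure Condition (dec : Code T → Set (Code T)) (A : Code T → Set T) where
  carrier : Finset (Code T × T)
  isModel : ∀ a ∈ carrier, IsModel dec a.1
  lt : ∀ a ∈ carrier, ∀ t, pt t ∈ dec a.1 → t < a.2
  chain : ∀ a ∈ carrier, ∀ b ∈ carrier, a = b ∨ (a.1 ∈ dec b.1 ∧ pt a.2 ∈ dec b.1) ∨
    (b.1 ∈ dec a.1 ∧ pt b.2 ∈ dec a.1)

variable {dec : Code T → Set (Code T)} {A : Code T → Set T}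

/-- An extension may insert new points below the point of an old model `b` only if they lie
in `A b`. -/
instance : Preorder (Condition dec A) where
  le q p := p.carrier ⊆ q.carrier ∧
    ∀ b ∈ p.carrier, ∀ a ∈ q.carrier, a ∉ p.carrier → a.2 < b.2 → a.2 ∈ A b.1
  le_refl p := ⟨Finset.Subset.refl _, fun _ _ _ h h' => (h' h).elim⟩
  le_trans r q p h1 h2 := ⟨h2.1.trans h1.1, fun b hb a ha ha' hab => by
    by_cases haq : a ∈ q.carrier
    · exact h2.2 b hb a haq ha' hab
    · exact h1.2 b (h2.1 hb) a ha haq hab⟩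

/-- The empty condition. -/
def Condition.empty : Condition dec A := ⟨∅, by simp, by simp, by simp⟩

instance : Nonempty (Condition dec A) := ⟨Condition.empty⟩

open Classical in
/-- The members of a condition that satisfy `φ` form a condition. -/
noncomputable def Condition.filter (p : Condition dec A) (φ : Code T × T → Prop) :
    Condition dec A :=
  ⟨p.carrier.filter φ, fun a ha => p.isModel a (Finset.mem_filter.1 ha).1,
    fun a ha => p.lt a (Finset.mem_filter.1 ha).1,
    fun a ha b hb => p.chain a (Finset.mem_filter.1 ha).1 b (Finset.mem_filter.1 hb).1⟩

theorem Condition.mem_filter {p : Condition dec A} {φ : Code T × T → Prop} {a : Code T × T} :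
    a ∈ (p.filter φ).carrier ↔ a ∈ p.carrier ∧ φ a := by
  classical
  exact Finset.mem_filter

theorem Condition.mem_of_lt {p : Condition dec A} {a b : Code T × T} (ha : a ∈ p.carrier)
    (hb : b ∈ p.carrier) (hab : a.2 < b.2) : a.1 ∈ dec b.1 ∧ pt a.2 ∈ dec b.1 := by
  rcases p.chain a ha b hb with rfl | h | h
  · exact (lt_irrefl _ hab).elim
  · exact h
  · exact (lt_asymm hab (p.lt a ha _ h.2)).elim

theorem Condition.eq_of_snd_eq {p : Condition dec A} {a b : Code T × T} (ha : a ∈ p.carrier)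
    (hb : b ∈ p.carrier) (hab : a.2 = b.2) : a = b := by
  rcases p.chain a ha b hb with h | h | h
  · exact h
  · exact ((p.lt b hb _ h.2).ne hab).elim
  · exact ((p.lt a ha _ h.2).ne hab.symm).elim

/-- If `m` is a model of `q`, then the members of `q` that do not lie in `m` are `m` itself and
models that contain `m`. -/
theorem Condition.subset_of_not_mem {q : Condition dec A} {m : Code T} {ξ : T}
    (hmq : (m, ξ) ∈ q.carrier) {b : Code T × T} (hb : b ∈ q.carrier)
    (hbm : ¬ (b.1 ∈ dec m ∧ pt b.2 ∈ dec m)) : dec m ⊆ dec b.1 ∧ ξ ≤ b.2 := by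
  rcases q.chain b hb _ hmq with rfl | h | h
  · exact ⟨Subset.rfl, le_rfl⟩
  · exact (hbm h).elim
  · exact ⟨(q.isModel b hb).trans _ h.1, (q.lt b hb _ h.2).le⟩

/-- A model that contains a condition can be put on top of it. -/
theorem Condition.exists_insert_top (p : Condition dec A) {m : Code T} (hm : IsModel dec m)
    (hp : ∀ a ∈ p.carrier, a.1 ∈ dec m ∧ pt a.2 ∈ dec m) {ξ : T}
    (hξ : ∀ t, pt t ∈ dec m → t < ξ) :
    ∃ q ≤ p, (m, ξ) ∈ q.carrier := by
  classical
  refine ⟨⟨insert (m, ξ) p.carrier, ?_, ?_, ?_⟩, ⟨Finset.subset_insert _ _, ?_⟩,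
    Finset.mem_insert_self _ _⟩
  · intro a ha
    rcases Finset.mem_insert.1 ha with rfl | ha
    · exact hm
    · exact p.isModel a ha
  · intro a ha
    rcases Finset.mem_insert.1 ha with rfl | ha
    · exact hξ
    · exact p.lt a ha
  · intro a ha b hb
    rcases Finset.mem_insert.1 ha with rfl | ha <;> rcases Finset.mem_insert.1 hb with rfl | hb
    · exact Or.inl rfl
    · exact Or.inr (Or.inr (hp b hb))
    · exact Or.inr (Or.inl (hp a ha))
    · exact p.chain a ha b hb
  · intro b hb a ha ha' hab
    rcases Finset.mem_insert.1 ha with rfl | ha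
    · exact (lt_asymm hab (hξ _ (hp b hb).2)).elim
    · exact (ha' ha).elim

/-- Amalgamation: let `m` be a model of `q`, let `r` be the part of `q` inside `m`, and let `s ≤ r`
be inside `m`. If the new points of `s` lie in `A b` for all members `b` of `q` outside `m`, then
`s` and `q` are compatible. -/
theorem Condition.exists_le_of_forall_mem {q r s : Condition dec A} {m : Code T} {ξ : T}
    (hmq : (m, ξ) ∈ q.carrier) (hr : r = q.filter fun a => a.1 ∈ dec m ∧ pt a.2 ∈ dec m)
    (hsr : s ≤ r) (hsm : ∀ a ∈ s.carrier, a.1 ∈ dec m ∧ pt a.2 ∈ dec m)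
    (hA : ∀ a ∈ s.carrier, a ∉ r.carrier → ∀ b ∈ q.carrier, b ∉ r.carrier → a.2 ∈ A b.1) :
    ∃ t, t ≤ s ∧ t ≤ q := by
  classical
  have hmem : ∀ a, a ∈ r.carrier ↔ a ∈ q.carrier ∧ a.1 ∈ dec m ∧ pt a.2 ∈ dec m := fun a => by
    rw [hr, Condition.mem_filter]
  have hout : ∀ b ∈ q.carrier, b ∉ r.carrier → dec m ⊆ dec b.1 ∧ ξ ≤ b.2 :=
    fun b hb hbr => subset_of_not_mem hmq hb fun h => hbr ((hmem b).2 ⟨hb, h⟩)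
  have hlt : ∀ a ∈ s.carrier, a.2 < ξ := fun a ha => q.lt _ hmq _ (hsm a ha).2
  have hcross : ∀ a ∈ s.carrier, ∀ b ∈ q.carrier, b ∉ s.carrier →
      a.1 ∈ dec b.1 ∧ pt a.2 ∈ dec b.1 := by
    intro a ha b hb hbs
    have := (hout b hb fun h => hbs (hsr.1 h)).1
    exact ⟨this (hsm a ha).1, this (hsm a ha).2⟩
  refine ⟨⟨s.carrier ∪ q.carrier, ?_, ?_, ?_⟩, ⟨Finset.subset_union_left, ?_⟩,
    ⟨Finset.subset_union_right, ?_⟩⟩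
  · intro a ha
    rcases Finset.mem_union.1 ha with ha | ha
    exacts [s.isModel a ha, q.isModel a ha]
  · intro a ha
    rcases Finset.mem_union.1 ha with ha | ha
    exacts [s.lt a ha, q.lt a ha]
  · intro a ha b hb
    by_cases has : a ∈ s.carrier <;> by_cases hbs : b ∈ s.carrier
    · exact s.chain a has b hbs
    · exact Or.inr (Or.inl (hcross a has b ((Finset.mem_union.1 hb).resolve_left hbs) hbs))
    · exact Or.inr (Or.inr (hcross b hbs a ((Finset.mem_union.1 ha).resolve_left has) has))
    · exact q.chain a ((Finset.mem_union.1 ha).resolve_left has) b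
        ((Finset.mem_union.1 hb).resolve_left hbs)
  · intro b hb a ha has hab
    have haq := (Finset.mem_union.1 ha).resolve_left has
    have := (hout a haq fun h => has (hsr.1 h)).2
    exact (lt_asymm hab ((hlt b hb).trans_le this)).elim
  · intro b hb a ha haq hab
    have has := (Finset.mem_union.1 ha).resolve_right haq
    have har : a ∉ r.carrier := fun h => haq ((hmem a).1 h).1
    by_cases hbr : b ∈ r.carrier
    · exact hsr.2 b hbr a has har hab
    · exact hA a has har b hb hbr

/-- The sequences through whose entries `r` can be extended to a member of `D` (level `0`) and, at
level `n + 1`, the sequences that unboundedly many one-point extensions put into level `n`. -/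
def level (D : Set (Condition dec A)) (r : Condition dec A) : ℕ → Code T
  | 0 => {l | ∃ s ∈ D, s ≤ r ∧ ∀ a ∈ s.carrier, a ∉ r.carrier → a.2 ∈ l}
  | n + 1 => {l | ¬ BddAbove {η | l ++ [η] ∈ level D r n}}

/-- The points of `q` outside `m`, in increasing order, witness that the empty sequence lies in
some level: each point is above its model, which contains the level and the preceding points. -/
theorem nil_mem_level {D : Set (Condition dec A)} {q r : Condition dec A} {m : Code T} {ξ : T}
    (hqD : q ∈ D) (hmq : (m, ξ) ∈ q.carrier)
    (hr : r = q.filter fun a => a.1 ∈ dec m ∧ pt a.2 ∈ dec m)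
    (hlev : ∀ n, level D r n ∈ dec m) : ∃ n, [] ∈ level D r n := by
  classical
  have hmem : ∀ a, a ∈ r.carrier ↔ a ∈ q.carrier ∧ a.1 ∈ dec m ∧ pt a.2 ∈ dec m := fun a => by
    rw [hr, Condition.mem_filter]
  have hout : ∀ b ∈ q.carrier, b ∉ r.carrier → dec m ⊆ dec b.1 ∧ ξ ≤ b.2 :=
    fun b hb hbr => Condition.subset_of_not_mem hmq hb fun h => hbr ((hmem b).2 ⟨hb, h⟩)
  have hqr : q ≤ r := ⟨fun a ha => ((hmem a).1 ha).1, fun b hb a ha har hab =>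
    (lt_asymm hab ((q.lt _ hmq _ ((hmem b).1 hb).2.2).trans_le (hout a ha har).2)).elim⟩
  let L := ((q.carrier \ r.carrier).image Prod.snd).sort (· ≤ ·)
  have hL : ∀ x, x ∈ L ↔ ∃ a ∈ q.carrier, a ∉ r.carrier ∧ a.2 = x := by
    intro x
    simp only [L, Finset.mem_sort, Finset.mem_image, Finset.mem_sdiff, and_assoc]
  have hsort : L.Pairwise (· < ·) := Finset.sortedLT_sort _ |>.pairwise
  have key : ∀ l₂ l₁ : List T, l₁ ++ l₂ = L → l₁ ∈ level D r l₂.length := by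
    intro l₂
    induction l₂ with
    | nil =>
      intro l₁ h
      refine ⟨q, hqD, hqr, fun a ha har => ?_⟩
      rw [List.append_nil] at h
      rw [h, hL]
      exact ⟨a, ha, har, rfl⟩
    | cons η l₂ ih =>
      intro l₁ h hbdd
      have hη : l₁ ++ [η] ∈ level D r l₂.length := ih (l₁ ++ [η]) (by simpa using h)
      obtain ⟨a, ha, har, rfl⟩ := (hL η).1 (by rw [← h]; simp)
      have hpre : ∀ x ∈ l₁, pt x ∈ dec a.1 := by
        intro x hx
        obtain ⟨b, hb, hbr, rfl⟩ := (hL x).1 (by rw [← h]; simp [hx])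
        rw [← h, List.pairwise_append] at hsort
        exact (Condition.mem_of_lt hb ha (hsort.2.2 _ hx _ (by simp))).2
      obtain ⟨b, hb, hbu⟩ := (q.isModel a ha).bound _ ((hout a ha har).1 (hlev _)) l₁ hpre hbdd
      exact (hbu hη).not_gt (q.lt a ha _ hb)
  exact ⟨L.length, key L [] rfl⟩

/-- A sequence in some level, with entries in `N`, extends inside `N` to a sequence in level `0`. The
new points may be chosen in the finitely many sets `A b`, because every unbounded set of one-point
extensions has an infinite subset in `N` that is almost contained in each of them. -/
theorem exists_mem_level_zero {D : Set (Condition dec A)} {r : Condition dec A} {N : Set (Code T)}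
    {B : Set (Code T × T)} (hB : B.Finite) (hlev : ∀ n, level D r n ∈ N)
    (hN : ∀ G ∈ N, ∀ l : List T, (∀ x ∈ l, pt x ∈ N) → ¬ BddAbove {η | l ++ [η] ∈ G} →
      ∃ y ⊆ {η | l ++ [η] ∈ G}, y.Infinite ∧ (∀ t ∈ y, pt t ∈ N) ∧ ∀ b ∈ B, (y \ A b.1).Finite) :
    ∀ (n : ℕ) (l : List T), l ∈ level D r n →
      (∀ x ∈ l, pt x ∈ N) → (∀ x ∈ l, ∀ b ∈ B, x ∈ A b.1) →
      ∃ l' ∈ level D r 0, (∀ x ∈ l', pt x ∈ N) ∧ ∀ x ∈ l', ∀ b ∈ B, x ∈ A b.1 := by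
  intro n
  induction n with
  | zero => exact fun l h1 h2 h3 => ⟨l, h1, h2, h3⟩
  | succ n ih =>
    intro l h1 h2 h3
    obtain ⟨y, hyG, hyinf, hyN, hyA⟩ := hN _ (hlev n) l h2 h1
    have hfin : (⋃ b ∈ B, y \ A b.1).Finite := hB.biUnion hyA
    obtain ⟨t, hty, ht⟩ := (hyinf.sdiff hfin).nonempty
    refine ih (l ++ [t]) (hyG hty) ?_ ?_
    · intro x hx
      rcases List.mem_append.1 hx with hx | hx
      · exact h2 x hx
      · rw [List.mem_singleton.1 hx]
        exact hyN t hty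
    · intro x hx b hb
      rcases List.mem_append.1 hx with hx | hx
      · exact h3 x hx b hb
      · rw [List.mem_singleton.1 hx]
        by_contra h
        exact ht (mem_biUnion hb ⟨hty, h⟩)

/-- Properness of the forcing. Given a countable set `M` closed under suitable operations, the trace
of `M` on the codes is put on top of `p` as a new model `m`. A condition `q` in a dense set below
this is reflected into `M`: the part `r` of `q` in `m` has an extension in `M` that lies in the same
dense set and has all its new points in the finitely many sets `A b` that restrict them. -/
theorem isProper_condition [Infinite T] (hT : ∀ c : Set T, c.Countable → ∃ b, ∀ x ∈ c, x < b)
    {I : Set (Set T)} (hIc : ∀ y ∈ I, y.Countable)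
    (hI : ∀ B : Set T, ¬ BddAbove B → ∃ y ⊆ B, y.Infinite ∧ y ∈ I)
    (hdec : ∀ u, (dec u).Countable)
    (hdec' : ∀ N : Set (Code T), N.Countable → N.Nonempty → ∃ u, dec u = N)
    (hA : ∀ v, ∀ w ∈ dec v, decodeSet w ∈ I → (decodeSet w \ A v).Finite) :
    IsProper (Condition dec A) := by
  classical
  refine isProper_of_holdsOnClub (Code T) fun Z D hD p => ?_
  let c : Code T → Z ⊕ Condition dec A ⊕ Code T := fun u => .inr (.inr u)
  let k : Condition dec A → Z ⊕ Condition dec A ⊕ Code T := fun r => .inr (.inl r)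
  have hcinj : Function.Injective c := fun u v h => by simpa [c] using h
  have hkinj : Function.Injective k := fun u v h => by simpa [k] using h
  have hy : ∀ (G : Code T) (l : List T), ∃ y : Set T, y.Countable ∧
      (¬ BddAbove {η | l ++ [η] ∈ G} → y ⊆ {η | l ++ [η] ∈ G} ∧ y.Infinite ∧ y ∈ I) := by
    intro G l
    by_cases h : BddAbove {η | l ++ [η] ∈ G}
    · exact ⟨∅, countable_empty, fun h' => (h' h).elim⟩
    · obtain ⟨y, hy⟩ := hI _ h
      exact ⟨y, hIc y hy.2.2, fun _ => hy⟩
  choose y hyc hy using hy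
  obtain ⟨bd, hbd⟩ := exists_bound (T := T)
  have hlist : Function.Injective fun j : Code T × List T => c j.1 :: j.2.map (c ∘ pt) := by
    rintro ⟨G, l⟩ ⟨G', l'⟩ h
    simp only [List.cons.injEq] at h
    exact Prod.ext (hcinj h.1) (List.map_injective_iff.2 (hcinj.comp pt_injective) h.2)
  have hparts : ∀ e : Finset (Z ⊕ Condition dec A ⊕ Code T),
      {r : Condition dec A | ∀ a ∈ r.carrier, c a.1 ∈ e ∧ c (pt a.2) ∈ e}.Countable := by
    intro e
    have hfin : {a : Code T × T | c a.1 ∈ e ∧ c (pt a.2) ∈ e}.Finite := by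
      refine ((e.finite_toSet.preimage hcinj.injOn).prod
        (e.finite_toSet.preimage (hcinj.comp pt_injective).injOn)).subset fun a ha => ?_
      exact ⟨ha.1, ha.2⟩
    refine ((countable_finset_subset hfin.countable).preimage_of_injOn
      (f := Condition.carrier) fun r _ s _ h => Condition.ext h).mono fun r hr => ?_
    exact fun a ha => hr a ha
  refine ((((((holdsOnClub_of_list (J := Z × Condition dec A) (fun j => [.inl j.1, k j.2]) ?_
      (fun j => range fun n => c (level (D j.1) j.2 n)) fun _ => countable_range _).and
    (holdsOnClub_of_list (fun j : Code T × List T => c j.1 :: j.2.map (c ∘ pt)) hlist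
      (fun j => insert (c (pt (bd j.1 j.2))) (insert (c (codeSet (y j.1 j.2)))
        ((c ∘ pt) '' y j.1 j.2))) fun j => (((hyc _ _).image _).insert _).insert _)).and
    (holdsOnClub_of_list (J := Code T) (fun v => [c v]) ?_ (fun v => c '' dec v)
      fun v => (hdec v).image _)).and
    (holdsOnClub_of_list
      (J := {j : Z × Condition dec A × List T // j.2.2 ∈ level (D j.1) j.2.1 0})
      (fun j => .inl j.1.1 :: k j.1.2.1 :: j.1.2.2.map (c ∘ pt)) ?_
      (fun j => {k (Classical.choose j.2)}) fun _ => countable_singleton _)).and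
    (holdsOnClub_closedUnder (fun e => k '' {r | ∀ a ∈ r.carrier, c a.1 ∈ e ∧ c (pt a.2) ∈ e})
      fun e => (hparts e).image _)).and
    (holdsOnClub_of_list (J := Condition dec A) (fun r => [k r]) ?_
      (fun r => ⋃ a ∈ r.carrier, {c a.1, c (pt a.2)})
      fun r => r.carrier.countable_toSet.biUnion fun _ _ => (countable_singleton _).insert _)).and
    (holdsOnClub_of_list (J := Unit) (fun _ => []) (fun _ _ _ => rfl) (fun _ => {k p, c ∅})
      fun _ => (countable_singleton _).insert _) |>.mono ?_
  · rintro ⟨z, r⟩ ⟨z', r'⟩ h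
    simp only [List.cons.injEq, Sum.inl.injEq, and_true] at h
    exact Prod.ext h.1 (hkinj h.2)
  · intro u v h
    simp only [List.cons.injEq, and_true] at h
    exact hcinj h
  · rintro ⟨⟨z, r, l⟩, hl⟩ ⟨⟨z', r', l'⟩, hl'⟩ h
    simp only [List.cons.injEq, Sum.inl.injEq] at h
    obtain ⟨rfl, h2, h3⟩ := h
    obtain rfl := hkinj h2
    obtain rfl := List.map_injective_iff.2 (hcinj.comp pt_injective) h3
    rfl
  · intro u v h
    simp only [List.cons.injEq, and_true] at h
    exact hkinj h
  -- the closure properties of `M`: levels, bounds and infinite members of `I`, elements of coded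
  -- sets, witnesses of level `0`, conditions with parts in `M`, parts of conditions, constants
  rintro M hMc ⟨⟨⟨⟨⟨⟨C1, C2⟩, C3⟩, C4⟩, C5⟩, C6⟩, C7⟩
  have C2 : ∀ G, c G ∈ M → ∀ l : List T, (∀ x ∈ l, c (pt x) ∈ M) →
      insert (c (pt (bd G l))) (insert (c (codeSet (y G l))) ((c ∘ pt) '' y G l)) ⊆ M :=
    fun G hG l hl => C2 (G, l) (by simpa using ⟨hG, hl⟩)
  obtain ⟨hpM, h0M⟩ : k p ∈ M ∧ c ∅ ∈ M := by
    have := C7 () (by simp)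
    exact ⟨this (by simp), this (by simp)⟩
  obtain ⟨m, hm⟩ := hdec' (c ⁻¹' M) (hMc.preimage_of_injOn hcinj.injOn) ⟨∅, h0M⟩
  have hmem : ∀ u, u ∈ dec m ↔ c u ∈ M := fun u => by rw [hm]; rfl
  have hCparts : ∀ r, k r ∈ M → ∀ a ∈ r.carrier, a.1 ∈ dec m ∧ pt a.2 ∈ dec m := by
    intro r hr a ha
    have : {c a.1, c (pt a.2)} ⊆ M := Subset.trans
      (subset_biUnion_of_mem (u := fun a : Code T × T => {c a.1, c (pt a.2)}) ha)
      (C6 r (by simpa using hr))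
    rw [hmem, hmem]
    exact ⟨this (by simp), this (by simp)⟩
  have hmodel : IsModel dec m := by
    refine ⟨fun v hv w hw => ?_, fun G hG l hl hb => ⟨bd G l, ?_, hbd G l hb⟩⟩
    · rw [hmem] at hv ⊢
      exact C3 v (by simpa using hv) ⟨w, hw, rfl⟩
    · simp only [hmem] at hG hl ⊢
      exact C2 G hG l hl (mem_insert _ _)
  obtain ⟨ξ, hξ⟩ := hT (pt ⁻¹' dec m) ((hdec m).preimage_of_injOn pt_injective.injOn)
  obtain ⟨q₀, hq₀p, hq₀⟩ := p.exists_insert_top hmodel (hCparts p hpM) hξ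
  refine ⟨q₀, hq₀p, fun z hz q₁ hq₁ => ?_⟩
  obtain ⟨q, hqD, hqq₁⟩ := hD z q₁
  have hmq : (m, ξ) ∈ q.carrier := (hqq₁.trans hq₁).1 hq₀
  let r := q.filter fun a => a.1 ∈ dec m ∧ pt a.2 ∈ dec m
  have hrM : k r ∈ M := by
    refine C5 (r.carrier.image (fun a => c a.1) ∪ r.carrier.image fun a => c (pt a.2)) ?_
      ⟨r, fun a ha => ?_, rfl⟩
    · intro x hx
      simp only [Finset.coe_union, Finset.coe_image, mem_union, mem_image] at hx
      rcases hx with ⟨a, ha, rfl⟩ | ⟨a, ha, rfl⟩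
      · exact (hmem _).1 (Condition.mem_filter.1 ha).2.1
      · exact (hmem _).1 (Condition.mem_filter.1 ha).2.2
    · exact ⟨Finset.mem_union_left _ (Finset.mem_image_of_mem _ ha),
        Finset.mem_union_right _ (Finset.mem_image.2 ⟨a, ha, rfl⟩)⟩
  have hlev : ∀ n, level (D z) r n ∈ dec m := fun n =>
    (hmem _).2 (C1 (z, r) (by simpa using ⟨hz, hrM⟩) ⟨n, rfl⟩)
  obtain ⟨n, hn⟩ := nil_mem_level hqD hmq rfl hlev
  let B : Set (Code T × T) := {b | b ∈ q.carrier ∧ b ∉ r.carrier}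
  have hB : B.Finite := q.carrier.finite_toSet.subset fun b hb => hb.1
  have hBm : ∀ b ∈ B, dec m ⊆ dec b.1 := fun b hb =>
    (Condition.subset_of_not_mem hmq hb.1 fun h => hb.2 (Condition.mem_filter.2 ⟨hb.1, h⟩)).1
  obtain ⟨l, hl0, hlm, hlA⟩ := exists_mem_level_zero hB hlev (by
    intro G hG l hl hbdd
    simp only [hmem] at hG hl
    have h2 := C2 G hG l hl
    obtain ⟨hy1, hy2, hy3⟩ := hy G l hbdd
    refine ⟨y G l, hy1, hy2, fun t ht => ?_, fun b hb => ?_⟩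
    · rw [hmem]
      exact h2 (mem_insert_of_mem _ (mem_insert_of_mem _ ⟨t, ht, rfl⟩))
    · have := hA b.1 (codeSet (y G l)) (hBm b hb
        ((hmem _).2 (h2 (mem_insert_of_mem _ (mem_insert _ _)))))
      rw [decodeSet_codeSet] at this
      exact this hy3) n [] hn (by simp) (by simp)
  have hsM := C4 ⟨(z, r, l), hl0⟩ (by
    simpa using ⟨hz, hrM, fun x hx => (hmem _).1 (hlm x hx)⟩) rfl
  obtain ⟨hsD, hsr, hsl⟩ := Classical.choose_spec hl0
  refine ⟨_, hsD, hsM, ?_⟩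
  obtain ⟨t, hts, htq⟩ := Condition.exists_le_of_forall_mem hmq rfl hsr (hCparts _ hsM)
    fun a ha har b hb hbr => hlA _ (hsl a ha har) b ⟨hb, hbr⟩
  exact ⟨t, hts, htq.trans hqq₁⟩

/-- The conditions one of whose models contains a given code are dense. -/
theorem isDense_setOf_mem (hT : ∀ c : Set T, c.Countable → ∃ b, ∀ x ∈ c, x < b) [Infinite T]
    (hdec : ∀ u, (dec u).Countable)
    (hdec' : ∀ N : Set (Code T), N.Countable → N.Nonempty → ∃ u, dec u = N) (u : Code T) :
    IsDense {p : Condition dec A | ∃ a ∈ p.carrier, u ∈ dec a.1} := by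
  classical
  intro p
  obtain ⟨bd, hbd⟩ := exists_bound (T := T)
  obtain ⟨H, hH, hM⟩ := (holdsOnClub_of_list (W := Code T)
      (fun j : Code T × List T => j.1 :: j.2.map pt) (by
        rintro ⟨G, l⟩ ⟨G', l'⟩ h
        simp only [List.cons.injEq] at h
        exact Prod.ext h.1 (List.map_injective_iff.2 pt_injective h.2))
      (fun j => {pt (bd j.1 j.2)}) fun _ => countable_singleton _).and
    (holdsOnClub_of_list (fun v => [v]) (fun u v h => by simpa using h) dec hdec)
  obtain ⟨M, hEM, hMc, hMcl⟩ := exists_countable_closedUnder H hH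
    (E := insert u (⋃ a ∈ p.carrier, {a.1, pt a.2}))
    ((p.carrier.countable_toSet.biUnion fun _ _ => (countable_singleton _).insert _).insert _)
  obtain ⟨C1, C2⟩ := hM M hMc hMcl
  have huM : u ∈ M := hEM (mem_insert _ _)
  obtain ⟨m, hm⟩ := hdec' M hMc ⟨u, huM⟩
  have hmodel : IsModel dec m := by
    rw [← hm] at C1 C2
    exact ⟨fun v hv => C2 v (by simpa using hv), fun G hG l hl hb =>
      ⟨bd G l, C1 (G, l) (by simpa using ⟨hG, hl⟩) rfl, hbd G l hb⟩⟩
  obtain ⟨ξ, hξ⟩ := hT (pt ⁻¹' dec m) ((hdec m).preimage_of_injOn pt_injective.injOn)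
  obtain ⟨q, hqp, hq⟩ := p.exists_insert_top hmodel (fun a ha => by
    have : {a.1, pt a.2} ⊆ M := Subset.trans
      (subset_biUnion_of_mem (u := fun a : Code T × T => {a.1, pt a.2}) ha)
      ((subset_insert _ _).trans hEM)
    rw [hm]
    exact ⟨this (by simp), this (by simp)⟩) hξ
  exact ⟨q, ⟨_, hq, hm ▸ huM⟩, hqp⟩

end Forcing

/-- A form of the P-ideal dichotomy. Let `I` be a family of countable sets that is countably
directed modulo finite sets. If every unbounded subset of `T` includes an infinite member of `I`,
then some uncountable `Z ⊆ T` has all its proper initial segments almost contained in members of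
`I`. -/
theorem ProperForcingAxiom.exists_uncountable (hPFA : ProperForcingAxiom.{u}) {T : Type u}
    [LinearOrder T] [Uncountable T] (hT : ∀ c : Set T, c.Countable → ∃ b, ∀ x ∈ c, x < b)
    {I : Set (Set T)} (hIc : ∀ y ∈ I, y.Countable)
    (hIP : ∀ 𝒴 ⊆ I, 𝒴.Countable → ∃ x ∈ I, ∀ y ∈ 𝒴, (y \ x).Finite)
    (hI : ∀ B : Set T, ¬ BddAbove B → ∃ y ⊆ B, y.Infinite ∧ y ∈ I) :
    ∃ Z : Set T, ¬ Z.Countable ∧ ∀ ζ ∈ Z, ∃ x ∈ I, ((Z ∩ Iio ζ) \ x).Finite := by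
  classical
  obtain ⟨dec, hdec, hdec'⟩ := exists_code T
  have hA : ∀ v : Code T, ∃ x ∈ I, ∀ w ∈ dec v, decodeSet w ∈ I → (decodeSet w \ x).Finite := by
    intro v
    obtain ⟨x, hx, h⟩ := hIP {y | y ∈ I ∧ y ∈ decodeSet '' dec v} (fun y hy => hy.1)
      (((hdec v).image _).mono fun y hy => hy.2)
    exact ⟨x, hx, fun w hw hwI => h _ ⟨hwI, w, hw, rfl⟩⟩
  choose A hAI hA using hA
  have hω : ∃ E : Set T, #E = ℵ₁ := by
    rw [← le_mk_iff_exists_set]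
    rw [← succ_aleph0, Order.succ_le_iff]
    exact (aleph0_lt_mk_iff).2 inferInstance
  obtain ⟨E, hE⟩ := hω
  obtain ⟨G, hG⟩ := hPFA (Condition dec A) (isProper_condition hT hIc hI hdec hdec' hA)
    (range fun t : E => {p : Condition dec A | ∃ a ∈ p.carrier, pt t.1 ∈ dec a.1})
    (mk_range_le.trans hE.le) (by
      rintro _ ⟨t, rfl⟩
      exact isDense_setOf_mem hT hdec hdec' _)
  let K : Set (Code T × T) := {a | ∃ p ∈ G, a ∈ p.carrier}
  have hK : ∀ a ∈ K, ∀ b ∈ K, a.2 = b.2 → a = b := by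
    rintro a ⟨p, hp, ha⟩ b ⟨q, hq, hb⟩ hab
    obtain ⟨r, hr, hrp, hrq⟩ := G.directed p hp q hq
    exact Condition.eq_of_snd_eq (hrp.1 ha) (hrq.1 hb) hab
  refine ⟨Prod.snd '' K, fun hc => ?_, ?_⟩
  · have hKc : K.Countable := countable_of_injective_of_countable_image (f := Prod.snd)
      (fun a ha b hb h => hK a ha b hb h) hc
    have : E.Countable := by
      refine ((hKc.biUnion fun a _ => hdec a.1).preimage_of_injOn pt_injective.injOn).mono ?_
      intro t ht
      obtain ⟨p, hpG, a, ha, hta⟩ := hG _ ⟨⟨t, ht⟩, rfl⟩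
      exact mem_biUnion (⟨p, hpG, ha⟩ : a ∈ K) hta
    rw [← le_aleph0_iff_set_countable, hE] at this
    exact (aleph0_lt_aleph_one.not_ge this)
  · rintro _ ⟨b, ⟨p, hp, hb⟩, rfl⟩
    refine ⟨A b.1, hAI _, (p.carrier.finite_toSet.image Prod.snd).subset ?_⟩
    rintro _ ⟨⟨⟨a, ⟨q, hq, ha⟩, rfl⟩, hab⟩, haA⟩
    obtain ⟨r, hr, hrp, hrq⟩ := G.directed p hp q hq
    refine ⟨a, ?_, rfl⟩
    by_contra hap
    exact haA (hrp.2 b hb a (hrq.1 ha) hap hab)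

end PFA

/-! ### Cardinal arithmetic -/

namespace PFA

open Set Cardinal

theorem mk_iUnion_le_of_forall_le {ι α : Type u} {f : ι → Set α} {c : Cardinal.{u}} (hc : ℵ₀ ≤ c)
    (hι : #ι ≤ c) (hf : ∀ i, #(f i) ≤ c) : #(⋃ i, f i) ≤ c :=
  (mk_iUnion_le f).trans <| (mul_le_mul' hι (ciSup_le' hf)).trans (mul_eq_self hc).le

theorem mk_Iio_toType_lt {κ : Cardinal.{u}} (x : κ.ord.ToType) : #(Iio x) < κ := by
  simpa using mk_Iio_lt x

theorem exists_forall_lt_of_mk_lt {μ : Cardinal.{u}} (hμ : μ.IsRegular) {c : Set μ.ord.ToType}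
    (hc : #c < μ) : ∃ b, ∀ x ∈ c, x < b := by
  have : ¬ IsCofinal c := fun h => by
    have h1 := Order.cof_le h
    rw [Ordinal.cof_toType, hμ.cof_ord] at h1
    exact h1.not_gt hc
  simpa [IsCofinal] using this

/-- A limit cardinal `κ` is the supremum of `cf κ` smaller cardinals. -/
theorem exists_cofinal_family {κ : Cardinal.{u}} (hκ : ∀ c < κ, Order.succ c < κ) {ι : Type u}
    (hι : #ι = κ.ord.cof) : ∃ f : ι → Cardinal.{u}, (∀ i, f i < κ) ∧ ∀ c < κ, ∃ i, c < f i := by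
  obtain ⟨s, hs, hsc⟩ := Order.exists_cof_eq κ.ord.ToType
  rw [Ordinal.cof_toType, ← hι] at hsc
  obtain ⟨e⟩ := Cardinal.eq.1 hsc.symm
  refine ⟨fun i => (Ordinal.ToType.mk.symm (e i).1).1.card, fun i => ?_, fun c hc => ?_⟩
  · exact Cardinal.lt_ord.1 (Ordinal.ToType.mk.symm (e i).1).2
  · obtain ⟨y, hy, hle⟩ := hs (Ordinal.ToType.mk ⟨(Order.succ c).ord, ord_lt_ord.2 (hκ c hc)⟩)
    refine ⟨e.symm ⟨y, hy⟩, (Order.lt_succ c).trans_le ?_⟩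
    beta_reduce
    rw [Equiv.apply_symm_apply, ← card_ord (Order.succ c)]
    refine Ordinal.card_le_card ?_
    have := Ordinal.ToType.mk.symm.monotone hle
    rw [OrderIso.symm_apply_apply] at this
    exact this

/-- A set of size at most `κ` is a union of sets of prescribed sizes that are unbounded in `κ`. -/
theorem exists_cover {κ : Cardinal.{u}} {α : Type u} (hα : #α ≤ κ) {ι : Type*}
    {f : ι → Cardinal.{u}} (hf : ∀ c < κ, ∃ i, c < f i) :
    ∃ B : ι → Set α, (∀ i, #(B i) ≤ f i) ∧ (∀ x, ∃ i, x ∈ B i) ∧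
      ∀ i j, f i ≤ f j → B i ⊆ B j := by
  obtain ⟨e⟩ : Nonempty (α ↪ κ.ord.ToType) := by
    rw [← Cardinal.le_def, mk_ord_toType]; exact hα
  let ρ : α → Ordinal.{u} := fun x => (Ordinal.ToType.mk.symm (e x)).1
  have hρ : Function.Injective ρ := fun x y h =>
    e.injective (Ordinal.ToType.mk.symm.injective (Subtype.ext h))
  refine ⟨fun i => {x | ρ x < (f i).ord}, fun i => ?_, fun x => ?_, fun i j hij x hx => ?_⟩
  · rw [← mk_ord_toType (f i)]
    refine mk_le_of_injective (f := fun x => Ordinal.ToType.mk ⟨ρ x.1, x.2⟩) fun x y h => ?_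
    have h' := Ordinal.ToType.mk.injective h
    exact Subtype.ext (hρ (Subtype.mk.inj h'))
  · obtain ⟨i, hi⟩ := hf (ρ x).card (lt_ord.1 (mem_Iio.1 (Ordinal.ToType.mk.symm (e x)).2))
    exact ⟨i, lt_ord.2 hi⟩
  · rw [mem_ofPred_eq] at hx ⊢
    exact hx.trans_le (ord_le_ord.2 hij)

/-- A subset of a strong limit cardinal `κ` of countable cofinality is determined by its traces on
countably many sets of size less than `κ`, each of which has fewer than `κ` subsets. -/
theorem two_power_le_power_aleph0 {κ : Cardinal.{u}} (hκ : κ.IsStrongLimit) {f : ℕ → Cardinal.{u}}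
    (hf : ∀ n, f n < κ) (hf' : ∀ c < κ, ∃ n, c < f n) : (2 : Cardinal.{u}) ^ κ ≤ κ ^ ℵ₀ := by
  obtain ⟨B, hB, hcov, -⟩ := exists_cover (mk_out κ).le hf'
  have hinj : Function.Injective fun (X : Set κ.out) (n : ℕ) => ((↑) : B n → κ.out) ⁻¹' X := by
    intro X Y h
    ext x
    obtain ⟨n, hn⟩ := hcov x
    have := congrFun h n
    exact Set.ext_iff.1 this ⟨x, hn⟩
  calc (2 : Cardinal.{u}) ^ κ = #(Set κ.out) := by rw [mk_set, mk_out]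
    _ ≤ #(∀ n, Set (B n)) := mk_le_of_injective hinj
    _ = prod fun n => #(Set (B n)) := mk_pi _
    _ ≤ prod fun _ : ℕ => κ := prod_le_prod _ _ fun n => by
        rw [mk_set]
        exact (hκ.isStrongPrelimit ((hB n).trans_lt (hf n))).le
    _ = κ ^ ℵ₀ := by simp [prod_const]

/-! ### A covering matrix -/

section Matrix

variable {T : Type u}

/-- The set of all points from which `β` can be reached by finitely many steps, each leading from
a member of `B γ` to `γ`. For sets `B n γ` that increase with `n` and cover `Iio γ`, the sets
`reach (B n) β` form a coherent covering matrix. -/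
def reach (B : T → Set T) (β : T) : Set T :=
  {α | Relation.ReflTransGen (fun x y => x ∈ B y) α β}

theorem reach_mono {B B' : T → Set T} (h : ∀ β, B β ⊆ B' β) (β : T) : reach B β ⊆ reach B' β :=
  fun _ hx => Relation.ReflTransGen.mono (fun _ _ h' => h _ h') _ _ hx

theorem reach_subset_reach {B : T → Set T} {α β : T} (h : α ∈ B β) : reach B α ⊆ reach B β :=
  fun _ hx => Relation.ReflTransGen.tail hx h

theorem mk_reach_le [LinearOrder T] [WellFoundedLT T] {B : T → Set T} (hB : ∀ β, B β ⊆ Iio β)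
    {c : Cardinal.{u}} (hc : ℵ₀ ≤ c) (hBc : ∀ β, #(B β) ≤ c) (β : T) : #(reach B β) ≤ c := by
  induction β using WellFoundedLT.induction with
  | ind β ih =>
    have : reach B β ⊆ {β} ∪ ⋃ α : B β, reach B α.1 := by
      intro x hx
      rcases Relation.ReflTransGen.cases_tail hx with h | ⟨y, hxy, hy⟩
      · exact Or.inl h.symm
      · exact Or.inr (mem_iUnion.2 ⟨⟨y, hy⟩, hxy⟩)
    refine (mk_le_mk_of_subset this).trans ((mk_union_le _ _).trans (add_le_of_le hc ?_ ?_))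
    · rw [mk_singleton]
      exact one_le_aleph0.trans hc
    · exact mk_iUnion_le_of_forall_le hc (hBc β) fun α => ih α.1 (hB β α.2)

/-- In a coherent matrix of countably many rows, the columns have, up to a shift of rows, a largest
trace on any given countable set: there are at most `2 ^ ℵ₀` traces, so one trace occurs unboundedly
often. -/
theorem exists_forall_inter_subset [LinearOrder T] {D : ℕ → T → Set T}
    (hcoh : ∀ α β, α < β → ∃ k, ∀ n ≥ k, D n α ⊆ D n β) (hmono : ∀ β, Monotone fun n => D n β)
    (hT : ∀ c : Set T, #c ≤ 2 ^ ℵ₀ → ∃ b, ∀ x ∈ c, x < b) {X : Set T} (hX : X.Countable) :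
    ∃ γ, ∀ β n, ∃ m, D n β ∩ X ⊆ D m γ := by
  let tr : T → ℕ → Set X := fun β n => {x | x.1 ∈ D n β}
  have hcard : #(ℕ → Set X) ≤ 2 ^ ℵ₀ := by
    have hX' : #X ≤ ℵ₀ := hX.le_aleph0
    have h1 : #(Set X) ≤ 2 ^ ℵ₀ := by
      rw [mk_set]
      exact power_le_power_left two_ne_zero hX'
    calc #(ℕ → Set X) = #(Set X) ^ ℵ₀ := by simp
      _ ≤ (2 ^ ℵ₀) ^ ℵ₀ := power_le_power_right h1
      _ = 2 ^ ℵ₀ := by rw [← power_mul, aleph0_mul_aleph0]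
  obtain ⟨s, hs⟩ : ∃ s, ¬ BddAbove {β | tr β = s} := by
    by_contra! h
    choose b hb using h
    obtain ⟨b', hb'⟩ := hT (range b) (mk_range_le.trans hcard)
    exact (hb (tr b') rfl).not_gt (hb' _ ⟨_, rfl⟩)
  obtain ⟨γ, hγ⟩ : {β | tr β = s}.Nonempty := by
    by_contra h
    rw [not_nonempty_iff_eq_empty] at h
    obtain ⟨b, -⟩ := hT ∅ (by simp)
    exact hs ⟨b, by simp [h]⟩
  refine ⟨γ, fun β n => ?_⟩
  obtain ⟨γ', hγ', hβ⟩ : ∃ γ', tr γ' = s ∧ β < γ' := by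
    by_contra! h
    exact hs ⟨β, fun x hx => h x hx⟩
  obtain ⟨k, hk⟩ := hcoh β γ' hβ
  refine ⟨max k n, fun x hx => ?_⟩
  have h1 : x ∈ D (max k n) γ' := hk _ (le_max_left _ _) (hmono β (le_max_right _ _) hx.1)
  have h2 : (⟨x, hx.2⟩ : X) ∈ tr γ (max k n) := by
    rw [hγ, ← hγ']
    exact h1
  exact h2

/-- Under the Proper Forcing Axiom, some unbounded set has all its countable subsets covered by
entries of the matrix. Otherwise the ideal of all countable sets that meet every entry of the matrix
in a finite set is a P-ideal as in `ProperForcingAxiom.exists_uncountable`, and it yields an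
uncountable set that meets no entry of the matrix in an infinite set. -/
theorem ProperForcingAxiom.exists_covered (hPFA : ProperForcingAxiom.{u}) [LinearOrder T]
    [Uncountable T] {D : ℕ → T → Set T} (hcov : ∀ α β, α < β → ∃ n, α ∈ D n β)
    (hmono : ∀ β, Monotone fun n => D n β) (hT : ∀ c : Set T, #c ≤ ℵ₁ → ∃ b, ∀ x ∈ c, x < b)
    (htr : ∀ X : Set T, X.Countable → ∃ γ, ∀ β n, ∃ m, D n β ∩ X ⊆ D m γ) :
    ∃ E : Set T, ¬ BddAbove E ∧ ∀ X ⊆ E, X.Countable → ∃ m γ, X ⊆ D m γ := by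
  let I : Set (Set T) := {x | x.Countable ∧ ∀ n β, (x ∩ D n β).Finite}
  by_cases hI : ∀ E : Set T, ¬ BddAbove E → ∃ y ⊆ E, y.Infinite ∧ y ∈ I
  · exfalso
    have hIP : ∀ 𝒴 ⊆ I, 𝒴.Countable → ∃ x ∈ I, ∀ y ∈ 𝒴, (y \ x).Finite := by
      intro 𝒴 h𝒴I h𝒴
      rcases 𝒴.eq_empty_or_nonempty with rfl | hne
      · exact ⟨∅, ⟨countable_empty, by simp⟩, by simp⟩
      obtain ⟨y, rfl⟩ := h𝒴.exists_eq_range hne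
      have hy : ∀ i, y i ∈ I := fun i => h𝒴I ⟨i, rfl⟩
      have hXc : (⋃ i, y i).Countable := countable_iUnion fun i => (hy i).1
      obtain ⟨γ, hγ⟩ := htr _ hXc
      have hsub : ⋃ i, y i \ D i γ ⊆ ⋃ i, y i := iUnion_mono fun i => sdiff_subset
      refine ⟨⋃ i, y i \ D i γ, ⟨hXc.mono hsub, fun n β => ?_⟩, ?_⟩
      · obtain ⟨m, hm⟩ := hγ β n
        refine ((finite_lt_nat m).biUnion fun i _ => (hy i).2 m γ).subset ?_
        rintro x ⟨hx, hxD⟩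
        have hxm := hm ⟨hxD, hsub hx⟩
        obtain ⟨i, hxi, hxi'⟩ := mem_iUnion.1 hx
        have him : i < m := by
          by_contra h
          exact hxi' (hmono γ (not_lt.1 h) hxm)
        exact mem_biUnion (show i ∈ {i | i < m} from him) ⟨hxi, hxm⟩
      · rintro _ ⟨i, rfl⟩
        refine ((hy i).2 i γ).subset fun x hx => ⟨hx.1, ?_⟩
        by_contra h
        exact hx.2 (mem_iUnion.2 ⟨i, hx.1, h⟩)
    obtain ⟨Z, hZ, hZI⟩ := hPFA.exists_uncountable
      (fun c hc => hT c (hc.le_aleph0.trans aleph0_lt_aleph_one.le)) (fun y hy => hy.1) hIP hI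
    -- a bounded uncountable part of `Z`, and an entry of the matrix that meets it in infinitely
    -- many points of a proper initial segment of `Z`
    obtain ⟨Z', hZ'Z, hZ'⟩ : ∃ Z' ⊆ Z, #Z' = ℵ₁ := by
      rw [← le_mk_iff_exists_subset, ← succ_aleph0, Order.succ_le_iff, ← not_le,
        le_aleph0_iff_set_countable]
      exact hZ
    obtain ⟨β, hβ⟩ := hT Z' hZ'.le
    obtain ⟨n, hn⟩ : ∃ n, ¬ (Z' ∩ D n β).Countable := by
      by_contra! h
      have : Z'.Countable := (countable_iUnion h).mono fun x hx => by
        obtain ⟨n, hn⟩ := hcov x β (hβ x hx)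
        exact mem_iUnion.2 ⟨n, hx, hn⟩
      rw [← le_aleph0_iff_set_countable, hZ'] at this
      exact aleph0_lt_aleph_one.not_ge this
    obtain ⟨Q, hQsub, hQinf, hQc⟩ : ∃ Q ⊆ Z' ∩ D n β, Q.Infinite ∧ Q.Countable := by
      have hinf : (Z' ∩ D n β).Infinite := fun h => hn h.countable
      obtain ⟨Q, hQ, hQ'⟩ := le_mk_iff_exists_subset.1 (infinite_iff.1 (infinite_coe_iff.2 hinf))
      exact ⟨Q, hQ, by rw [← infinite_coe_iff, infinite_iff, hQ'],
        by rw [← le_aleph0_iff_set_countable, hQ']⟩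
    obtain ⟨ζ, hζ, hQζ⟩ : ∃ ζ ∈ Z, ∀ x ∈ Q, x < ζ := by
      by_contra! h
      have hZcov : Z ⊆ ⋃ x ∈ Q, Z ∩ Iic x := fun ζ hζ => by
        obtain ⟨x, hx, hle⟩ := h ζ hζ
        exact mem_biUnion hx ⟨hζ, hle⟩
      refine hZ ((hQc.biUnion fun x hx => ?_).mono hZcov)
      have hxZ : x ∈ Z := hZ'Z (hQsub hx).1
      obtain ⟨y, hy, hfin⟩ := hZI x hxZ
      refine ((hfin.countable.union hy.1).insert x).mono ?_
      rintro z ⟨hz, hzx⟩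
      rcases hzx.eq_or_lt with rfl | hzx
      · exact mem_insert _ _
      · by_cases hzy : z ∈ y
        · exact Or.inr (Or.inr hzy)
        · exact Or.inr (Or.inl ⟨⟨hz, hzx⟩, hzy⟩)
    obtain ⟨y, hy, hfin⟩ := hZI ζ hζ
    refine hQinf ((hfin.union (hy.2 n β)).subset fun x hx => ?_)
    by_cases hxy : x ∈ y
    · exact Or.inr ⟨hxy, (hQsub hx).2⟩
    · exact Or.inl ⟨⟨hZ'Z (hQsub hx).1, hQζ x hx⟩, hxy⟩
  · push Not at hI
    obtain ⟨E, hE, hEI⟩ := hI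
    refine ⟨E, hE, fun X hX hXc => ?_⟩
    obtain ⟨γ, hγ⟩ := htr X hXc
    by_contra! h
    -- a set with a point outside each `D m γ` meets each of these sets in a finite set
    have h' : ∀ m, ∃ x ∈ X, x ∉ D m γ := fun m => not_subset.1 (h m γ)
    choose x hxX hx using h'
    have hfin : ∀ m, (range x ∩ D m γ).Finite := fun m => by
      refine ((finite_lt_nat m).image x).subset ?_
      rintro _ ⟨⟨i, rfl⟩, hi⟩
      refine ⟨i, ?_, rfl⟩
      by_contra h
      exact hx i (hmono γ (not_lt.1 h) hi)
    have hsub : range x ⊆ X := by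
      rintro _ ⟨i, rfl⟩
      exact hxX i
    refine hEI (range x) (hsub.trans hX) ?_ ⟨countable_range x, fun n β => ?_⟩
    · intro hr
      obtain ⟨γ', hγ'⟩ := hT (insert γ (range x)) (by
        exact (le_aleph0_iff_set_countable.2 ((countable_range x).insert γ)).trans
          aleph0_lt_aleph_one.le)
      choose! i hi using fun t (ht : t ∈ range x) => hcov t γ' (hγ' t (Or.inr ht))
      obtain ⟨N, hN⟩ := (hr.image i).bddAbove
      obtain ⟨m, hm⟩ := hγ γ' N
      refine hx m (hm ⟨hmono γ' (hN ⟨x m, ⟨m, rfl⟩, rfl⟩) (hi _ ⟨m, rfl⟩), hxX m⟩)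
    · obtain ⟨m, hm⟩ := hγ β n
      exact (hfin m).subset fun t ht => ⟨ht.1, hm ⟨ht.2, hsub ht.1⟩⟩

end Matrix

/-- The Singular Cardinal Hypothesis at cardinals `κ` of countable cofinality. An unbounded `E ⊆ κ⁺`
whose countable subsets are covered by the `κ⁺` many entries of a matrix, each of size less than
`κ`, has at most `κ⁺` countable subsets. Hence `2 ^ κ ≤ κ ^ ℵ₀ ≤ κ⁺`. -/
theorem ProperForcingAxiom.two_power_le_succ (hPFA : ProperForcingAxiom.{u}) {κ : Cardinal.{u}}
    (hκ : κ.IsStrongLimit) (hκω : ℵ₀ < κ) (hcof : κ.ord.cof = ℵ₀) : 2 ^ κ ≤ Order.succ κ := by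
  obtain ⟨g, hg, hg'⟩ := exists_cofinal_family (fun c hc => hκ.isSuccLimit.succ_lt hc)
    (ι := ULift.{u} ℕ) (by simp [hcof])
  let f : ℕ → Cardinal.{u} := partialSups fun n => max ℵ₀ (g ⟨n⟩)
  have hfω : ∀ n, ℵ₀ ≤ f n := fun n =>
    (le_max_left _ _).trans (le_partialSups (fun n => max ℵ₀ (g ⟨n⟩)) n)
  have hfκ : ∀ n, f n < κ := by
    intro n
    induction n with
    | zero => simpa [f] using ⟨hκω, hg _⟩
    | succ n ih => 
      simp only [f, partialSups_add_one]
      exact sup_lt_iff.2 ⟨ih, max_lt hκω (hg _)⟩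
  have hfmono : Monotone f := (partialSups _).monotone
  have hf : ∀ c < κ, ∃ n, c < f n := fun c hc => by
    obtain ⟨⟨n⟩, hn⟩ := hg' c hc
    exact ⟨n, hn.trans_le ((le_max_right _ _).trans
      (le_partialSups (fun n => max ℵ₀ (g ⟨n⟩)) n))⟩
  let T := (Order.succ κ).ord.ToType
  have hTcard : #T = Order.succ κ := mk_ord_toType _
  have hκsucc : κ < Order.succ κ := Order.lt_succ κ
  have : Uncountable T := by
    rw [← aleph0_lt_mk_iff, hTcard]
    exact hκω.trans hκsucc
  have hT : ∀ c : Set T, #c ≤ κ → ∃ b, ∀ x ∈ c, x < b := fun c hc =>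
    exists_forall_lt_of_mk_lt (isRegular_succ hκω.le) (hc.trans_lt hκsucc)
  have h2ω : (2 : Cardinal.{u}) ^ ℵ₀ < κ := hκ.isStrongPrelimit hκω
  have hIio : ∀ β : T, #(Iio β) ≤ κ := fun β => Order.lt_succ_iff.1 (mk_Iio_toType_lt β)
  have hB : ∀ β : T, ∃ B : ℕ → Set T, (∀ n, B n ⊆ Iio β) ∧ (∀ n, #(B n) ≤ f n) ∧
      (∀ x < β, ∃ n, x ∈ B n) ∧ Monotone B := by
    intro β
    obtain ⟨B, hB1, hB2, hB3⟩ := exists_cover (hIio β) hf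
    refine ⟨fun n => Subtype.val '' B n, fun n => ?_, fun n => mk_image_le.trans (hB1 n),
      fun x hx => ?_, fun n m hnm => image_mono (hB3 n m (hfmono hnm))⟩
    · rintro _ ⟨x, -, rfl⟩
      exact x.2
    · obtain ⟨n, hn⟩ := hB2 ⟨x, hx⟩
      exact ⟨n, _, hn, rfl⟩
  choose B hBsub hBcard hBcov hBmono using hB
  let D : ℕ → T → Set T := fun n => reach fun β => B β n
  have hDmono : ∀ β, Monotone fun n => D n β := fun β n m hnm =>
    reach_mono (fun γ => hBmono γ hnm) β
  have hDcoh : ∀ α β, α < β → ∃ k, ∀ n ≥ k, D n α ⊆ D n β := fun α β hαβ => by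
    obtain ⟨k, hk⟩ := hBcov β α hαβ
    exact ⟨k, fun n hn => reach_subset_reach (hBmono β hn hk)⟩
  have hDcov : ∀ α β, α < β → ∃ n, α ∈ D n β := fun α β hαβ => by
    obtain ⟨k, hk⟩ := hDcoh α β hαβ
    exact ⟨k, hk k le_rfl Relation.ReflTransGen.refl⟩
  have hDcard : ∀ n β, #(D n β) < κ := fun n β =>
    (mk_reach_le (fun β => hBsub β n) (hfω n) (fun β => hBcard β n) β).trans_lt (hfκ n)
  have hω₁ : ℵ₁ ≤ κ := by rw [← succ_aleph0]; exact Order.succ_le_of_lt hκω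
  obtain ⟨E, hE, hEcov⟩ := hPFA.exists_covered hDcov hDmono (fun c hc => hT c (hc.trans hω₁))
    fun X hX => exists_forall_inter_subset hDcoh hDmono (fun c hc => hT c (hc.trans h2ω.le)) hX
  have hEcard : Order.succ κ ≤ #E := by
    rw [Order.succ_le_iff]
    by_contra! h
    obtain ⟨b, hb⟩ := hT E h
    exact hE ⟨b, fun x hx => (hb x hx).le⟩
  have hsucc : ℵ₀ ≤ Order.succ κ := hκω.le.trans hκsucc.le
  have hcount : #(ℕ → E) ≤ Order.succ κ := by
    have hcover : (univ : Set (ℕ → E)) ⊆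
        ⋃ j : ULift.{u} ℕ × T, {h | ∀ i, (h i).1 ∈ D j.1.down j.2} := by
      intro h _
      obtain ⟨m, γ, hm⟩ := hEcov (range fun i => (h i).1)
        (by rintro _ ⟨i, rfl⟩; exact (h i).2) (countable_range _)
      exact mem_iUnion.2 ⟨(⟨m⟩, γ), fun i => hm ⟨i, rfl⟩⟩
    rw [← mk_univ]
    refine (mk_le_mk_of_subset hcover).trans (mk_iUnion_le_of_forall_le hsucc ?_ fun j => ?_)
    · rw [mk_prod]
      refine mul_le_of_le hsucc ?_ ?_
      · simpa using hsucc
      · simp [hTcard]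
    · have : #{h : ℕ → E | ∀ i, (h i).1 ∈ D j.1.down j.2} ≤ #(ℕ → D j.1.down j.2) :=
        mk_le_of_injective (f := fun h i => ⟨(h.1 i).1, h.2 i⟩) fun h h' hh => by
          refine Subtype.ext (funext fun i => Subtype.ext ?_)
          have := congrFun hh i
          exact Subtype.mk.inj this
      refine this.trans (le_trans ?_ hκsucc.le)
      have hlt := hDcard j.1.down j.2
      calc #(ℕ → D j.1.down j.2) = #(D j.1.down j.2) ^ ℵ₀ := by simp
        _ ≤ (2 ^ max ℵ₀ #(D j.1.down j.2)) ^ ℵ₀ :=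
            power_le_power_right ((cantor _).le.trans
              (power_le_power_left two_ne_zero (le_max_right _ _)))
        _ = 2 ^ max ℵ₀ #(D j.1.down j.2) := by
            rw [← power_mul, mul_eq_left (le_max_left _ _) (le_max_left _ _) aleph0_ne_zero]
        _ ≤ κ := (hκ.isStrongPrelimit (max_lt hκω hlt)).le
  calc (2 : Cardinal.{u}) ^ κ ≤ κ ^ ℵ₀ := two_power_le_power_aleph0 hκ hfκ hf
    _ ≤ #E ^ ℵ₀ := power_le_power_right (hκsucc.le.trans hEcard)
    _ = #(ℕ → E) := by simp
    _ ≤ Order.succ κ := hcount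

end PFA

/-! ### Singular cardinals of uncountable cofinality -/

namespace PFA

open Set Cardinal

/-- If any two distinct elements are `R`-comparable and every element has at most `κ` many
`R`-predecessors, then there are at most `κ⁺` many elements. -/
theorem mk_le_succ_of_forall_mk_le {α : Type u} {κ : Cardinal.{u}} (hκ : ℵ₀ ≤ κ) (R : α → α → Prop)
    (hR : ∀ x y, x ≠ y → R x y ∨ R y x) (hc : ∀ y, #{x | R x y} ≤ κ) : #α ≤ Order.succ κ := by
  by_contra! h
  obtain ⟨S, hS⟩ := le_mk_iff_exists_set.1 h.le
  have hκs : κ ≤ Order.succ κ := (Order.lt_succ κ).le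
  have hU : #(⋃ y : S, insert y.1 {x | R x y.1} : Set α) ≤ Order.succ κ :=
    mk_iUnion_le_of_forall_le (hκ.trans hκs) hS.le fun y => (mk_insert_le).trans
      (add_le_of_le (hκ.trans hκs) ((hc _).trans hκs) (one_le_aleph0.trans (hκ.trans hκs)))
  obtain ⟨x, hx⟩ : ∃ x, x ∉ (⋃ y : S, insert y.1 {x | R x y.1} : Set α) := by
    by_contra! h'
    rw [eq_univ_of_forall h', mk_univ] at hU
    exact h.not_ge hU
  have hsub : S ⊆ {y | R y x} := fun y hy => by
    have hx' : ¬ (x = y ∨ R x y) := fun h' => hx (mem_iUnion.2 ⟨⟨y, hy⟩, h'⟩)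
    push Not at hx'
    exact (hR y x (Ne.symm hx'.1)).resolve_right hx'.2
  have := (mk_le_mk_of_subset hsub).trans (hc x)
  rw [hS] at this
  exact this.not_gt (Order.lt_succ κ)

/-- In a regular uncountable cardinal, the closure points of a function are unbounded. -/
theorem exists_forall_lt_lt {μ : Cardinal.{u}} (hμ : μ.IsRegular) (hμω : ℵ₀ < μ)
    (b : μ.ord.ToType → μ.ord.ToType) (x₀ : μ.ord.ToType) : ∃ α, x₀ < α ∧ ∀ i < α, b i < α := by
  have hbdd : ∀ c : Set μ.ord.ToType, #c < μ → ∃ b, ∀ x ∈ c, x < b :=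
    fun c hc => exists_forall_lt_of_mk_lt hμ hc
  have he : ∀ x : μ.ord.ToType, ∃ y, x < y ∧ ∀ i < x, b i < y := by
    intro x
    obtain ⟨y, hy⟩ := hbdd (insert x (b '' Iio x)) (mk_insert_le.trans_lt
      (add_lt_of_lt hμω.le (mk_image_le.trans_lt (mk_Iio_toType_lt x))
        (one_lt_aleph0.trans hμω)))
    exact ⟨y, hy x (mem_insert _ _), fun i hi => hy _ (mem_insert_of_mem _ ⟨i, hi, rfl⟩)⟩
  choose e he he' using he
  let s : ℕ → μ.ord.ToType := fun n => e^[n] x₀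
  have hs : ∀ n, s (n + 1) = e (s n) := fun n => Function.iterate_succ_apply' _ _ _
  obtain ⟨y, hy⟩ := hbdd (range s)
    ((le_aleph0_iff_set_countable.2 (countable_range s)).trans_lt hμω)
  obtain ⟨α, hα, hmin⟩ := WellFounded.has_min wellFounded_lt {y | ∀ n, s n < y}
    ⟨y, fun n => hy _ ⟨n, rfl⟩⟩
  refine ⟨α, hα 0, fun i hi => ?_⟩
  obtain ⟨n, hn⟩ : ∃ n, i ≤ s n := by
    by_contra! h
    exact hmin i h hi
  have h1 : i < s (n + 1) := hn.trans_lt (by rw [hs]; exact he _)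
  exact (he' _ i h1).trans (by rw [← hs]; exact hα _)

/-- Silver's theorem: if `κ` is a strong limit cardinal of uncountable cofinality and `2 ^ ν = ν⁺`
for all singular strong limit cardinals `ν < κ`, then `2 ^ κ = κ⁺`. -/
theorem two_power_le_succ_of_forall_lt {κ : Cardinal.{u}} (hκ : κ.IsStrongLimit)
    (hμκ : κ.ord.cof < κ) (hμω : ℵ₀ < κ.ord.cof)
    (ih : ∀ ν < κ, ν.IsSingular → ν.IsStrongLimit → 2 ^ ν ≤ Order.succ ν) :
    2 ^ κ ≤ Order.succ κ := by
  classical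
  set μ := κ.ord.cof with hμdef
  have hμ : μ.IsRegular := isRegular_cof (Ordinal.one_lt_cof_iff.1 (one_lt_aleph0.trans hμω))
  have hκω : ℵ₀ ≤ κ := hμω.le.trans hμκ.le
  let M := μ.ord.ToType
  have hMcard : #M = μ := mk_ord_toType _
  obtain ⟨f₀, hf₀, hf₀'⟩ := exists_cofinal_family (fun c hc => hκ.isSuccLimit.succ_lt hc) hMcard
  let f : M → Cardinal.{u} := fun i => max μ (f₀ i)
  have hfμ : ∀ i, μ ≤ f i := fun i => le_max_left _ _
  have hfω : ∀ i, ℵ₀ ≤ f i := fun i => hμω.le.trans (hfμ i)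
  have hfκ : ∀ i, f i < κ := fun i => max_lt hμκ (hf₀ i)
  have hf : ∀ c < κ, ∃ i, c < f i := fun c hc => by
    obtain ⟨i, hi⟩ := hf₀' c hc
    exact ⟨i, hi.trans_le (le_max_right _ _)⟩
  choose b₀ hb₀ using fun i => hf _ (hκ.isStrongPrelimit (hfκ i))
  let ν : M → Cardinal.{u} := fun α => ⨆ i : Iio α, f i
  have hfν : ∀ α, ∀ i < α, f i ≤ ν α := fun α i hi =>
    le_ciSup (f := fun i : Iio α => f i) (bddAbove_of_small) ⟨i, hi⟩
  have hνlt : ∀ α, ∀ c < ν α, ∃ i : Iio α, c < f i := fun α c hc => exists_lt_of_lt_ciSup' hc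
  have hνκ : ∀ α, ν α < κ := fun α =>
    iSup_lt_of_lt_cof_ord (mk_Iio_toType_lt α) fun i => hfκ i
  -- at closure points of `b₀`, the cardinal `ν α` is a singular strong limit
  let Good : M → Prop := fun α => (∃ i, i < α) ∧ ∀ i < α, b₀ i < α
  have hνμ : ∀ α, Good α → μ ≤ ν α := fun α hα => by
    obtain ⟨⟨i, hi⟩, -⟩ := hα
    exact (hfμ i).trans (hfν α i hi)
  have hGood : ∀ α, Good α → 2 ^ ν α ≤ Order.succ (ν α) := by
    intro α hα
    have hμν := hνμ α hα
    have hpow : ∀ i < α, 2 ^ f i < ν α := fun i hi =>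
      (hb₀ i).trans_le (hfν α _ (hα.2 i hi))
    refine ih _ (hνκ α) (.of_not_isRegular (hμω.le.trans hμν) fun hreg => ?_) ⟨?_, fun c hc => ?_⟩
    · refine (iSup_lt_of_lt_cof_ord (a := ν α)
        (by rw [hreg.cof_ord]; exact (mk_Iio_toType_lt α).trans_le hμν)
        (f := fun i : Iio α => f i) fun i => ?_).ne rfl
      exact (cantor _).trans (hpow i i.2)
    · exact (aleph0_pos.trans (hμω.trans_le hμν)).ne'
    · obtain ⟨i, hi⟩ := hνlt α c hc
      exact (power_le_power_left two_ne_zero hi.le).trans_lt (hpow i i.2)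
  -- subsets of `κ` are represented by functions on the good points
  obtain ⟨B, hB, hcov, -⟩ := exists_cover (mk_out κ).le hf
  let K : M → Set κ.out := fun α => ⋃ i : Iio α, B i
  have hg : ∀ α, ∃ g : Set κ.out → (Order.succ (ν α)).ord.ToType,
      Good α → ∀ X Y, g X = g Y → X ∩ K α = Y ∩ K α := by
    intro α
    by_cases hα : Good α
    · have hμν := hνμ α hα
      have hK : #(K α) ≤ ν α := mk_iUnion_le_of_forall_le (hμω.le.trans hμν)
        ((mk_Iio_toType_lt α).le.trans hμν) fun i => (hB i).trans (hfν α i i.2)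
      have : #(Set (K α)) ≤ #(Order.succ (ν α)).ord.ToType := by
        rw [mk_set, mk_ord_toType]
        exact (power_le_power_left two_ne_zero hK).trans (hGood α hα)
      obtain ⟨e⟩ := this
      refine ⟨fun X => e ((↑) ⁻¹' X), fun _ X Y h => ?_⟩
      have := e.injective h
      rwa [Subtype.preimage_coe_eq_preimage_coe_iff, inter_comm, inter_comm _ Y] at this
    · have : Nonempty (Order.succ (ν α)).ord.ToType := by
        rw [← mk_ne_zero_iff, mk_ord_toType]
        exact (Order.bot_lt_succ _).ne'
      exact ⟨fun _ => Classical.arbitrary _, fun h => (hα h).elim⟩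
  choose g hg using hg
  have hsep : ∀ X Y : Set κ.out, X ≠ Y → ∃ i, ∀ α > i, Good α → g α X ≠ g α Y := by
    intro X Y hXY
    obtain ⟨x, hx⟩ : ∃ x, ¬ (x ∈ X ↔ x ∈ Y) := by
      by_contra! h
      exact hXY (ext h)
    obtain ⟨i, hi⟩ := hcov x
    refine ⟨i, fun α hα hgood h => hx ?_⟩
    have hxK : x ∈ K α := mem_iUnion.2 ⟨⟨i, hα⟩, hi⟩
    have := Set.ext_iff.1 (hg α hgood X Y h) x
    simpa [hxK] using this
  -- `Big S`: the good points in `S` form a stationary set, expressed through closure points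
  let Big : Set M → Prop := fun S => ∀ b : M → M, ∃ α ∈ S, Good α ∧ ∀ i < α, b i < α
  refine (show #(Set κ.out) = 2 ^ κ by rw [mk_set, mk_out]) ▸
    mk_le_succ_of_forall_mk_le hκω (fun X Y => Big {α | g α X < g α Y}) ?_ ?_
  · intro X Y hXY
    by_contra! h
    simp only [Big, not_forall, not_exists, not_and] at h
    obtain ⟨⟨b₁, h₁⟩, b₂, h₂⟩ := h
    obtain ⟨i, hi⟩ := hsep X Y hXY
    obtain ⟨α, hiα, hα⟩ := exists_forall_lt_lt hμ hμω (fun j => max (b₀ j) (max (b₁ j) (b₂ j))) i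
    have hgood : Good α := ⟨⟨i, hiα⟩, fun j hj => (le_max_left _ _).trans_lt (hα j hj)⟩
    rcases lt_or_gt_of_ne (hi α hiα hgood) with hlt | hlt
    · obtain ⟨j, hj, hj'⟩ := h₁ α hlt hgood
      exact hj' ((le_max_left _ _).trans_lt ((le_max_right _ _).trans_lt (hα j hj)))
    · obtain ⟨j, hj, hj'⟩ := h₂ α hlt hgood
      exact hj' ((le_max_right _ _).trans_lt ((le_max_right _ _).trans_lt (hα j hj)))
  · intro Y
    -- there are only `ν α` values below `g α Y`, so each of them has a code in some `f i` with `i <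
    -- α`
    have he : ∀ α, Nonempty (Iio (g α Y) ↪ Σ i : Iio α, (f i).out) := fun α => by
      rw [← Cardinal.le_def, mk_sigma]
      simp only [mk_out]
      exact (Order.lt_succ_iff.1 (mk_Iio_toType_lt (g α Y))).trans (iSup_le_sum _)
    let e := fun α => (he α).some
    let Q : ∀ i : M, Set κ.out → M → (f i).out → Prop := fun i X α a =>
      Good α ∧ ∃ (h : g α X < g α Y) (hi : i < α), e α ⟨g α X, h⟩ = ⟨⟨i, hi⟩, a⟩
    -- pressing down: `i` does not depend on `α`, for unboundedly many `α`
    have hpress : ∀ X, Big {α | g α X < g α Y} → ∃ i, ∀ j, ∃ α > j, ∃ a, Q i X α a := by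
      intro X hX
      by_contra! h
      choose b hb using h
      obtain ⟨α, hα, hgood, hcl⟩ := hX b
      have hlt : g α X < g α Y := hα
      let p := e α ⟨g α X, hlt⟩
      exact hb p.1 α (hcl _ p.1.2) p.2 ⟨hgood, hlt, p.1.2, rfl⟩
    let φ : ∀ i : M, Set κ.out → M → Set (f i).out := fun i X α => {a | Q i X α a}
    have hφ : ∀ i X X', (∀ j, ∃ α > j, ∃ a, Q i X α a) → φ i X = φ i X' → X = X' := by
      intro i X X' hX h
      by_contra hne
      obtain ⟨j, hj⟩ := hsep X X' hne
      obtain ⟨α, hα, a, ha⟩ := hX j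
      have ha' : Q i X' α a := (Set.ext_iff.1 (congrFun h α) a).1 ha
      obtain ⟨hgood, h₁, hi, h₂⟩ := ha
      obtain ⟨-, h₁', hi', h₂'⟩ := ha'
      exact hj α hα hgood (Subtype.mk.inj ((e α).injective (h₂.trans h₂'.symm)))
    choose ix hix using fun X : {X | Big {α | g α X < g α Y}} => hpress X.1 X.2
    have hinj : Function.Injective fun X =>
        (⟨ix X, φ (ix X) X.1⟩ : Σ i : M, M → Set (f i).out) := by
      intro X X' h
      simp only [Sigma.mk.injEq] at h
      obtain ⟨h1, h2⟩ := h
      rw [← h1] at h2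
      exact Subtype.ext (hφ _ X.1 X'.1 (hix X) (eq_of_heq h2))
    refine (mk_le_of_injective hinj).trans ?_
    rw [mk_sigma]
    refine (sum_le_mk_mul_iSup _).trans (mul_le_of_le hκω (hMcard.trans_le hμκ.le)
      (ciSup_le' fun i => ?_))
    calc #(M → Set (f i).out) = (2 ^ f i) ^ μ := by simp [hMcard]
      _ = 2 ^ f i := by rw [← power_mul, mul_eq_left (hfω i) (hfμ i) hμ.ne_zero]
      _ ≤ κ := (hκ.isStrongPrelimit (hfκ i)).le

end PFA

theorem mainTheorem2 (hPFA : PFA.ProperForcingAxiom.{u}) :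
    PFA.SingularCardinalHypothesis.{u} := by
  intro κ
  induction κ using WellFoundedLT.induction with
  | ind κ ih =>
    intro hsing hlim
    refine le_antisymm ?_ (Order.succ_le_of_lt (Cardinal.cantor κ))
    have hω : Cardinal.aleph0 ≤ κ.ord.cof := by
      rw [Ordinal.aleph0_le_cof_iff, Ordinal.one_lt_cof_iff]
      exact Cardinal.isSuccLimit_ord hsing.aleph0_le
    rcases hω.eq_or_lt with h | h
    · exact hPFA.two_power_le_succ hlim (h ▸ hsing.cof_ord_lt) h.symm
    · exact PFA.two_power_le_succ_of_forall_lt hlim hsing.cof_ord_lt h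
        fun ν hν h1 h2 => (ih ν hν h1 h2).le
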